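/- Let $\dot H^1(\mathbb{R}^3)$ be the homogeneous Sobolev space, i.e. the completion of $C_c^\infty(\mathbb{R}^3)$ for the norm $\|\nabla \varphi\|_{L^2}$, realised as a space of locally integrable functions: $u\in\dot H^1(\mathbb{R}^3)$, with gradient $G \in L^2(\mathbb{R}^3)$, if there are $\varphi_n\in C_c^\infty(\mathbb{R}^3)$ with $\varphi_n\to u$ in $L^1_{loc}$ and $\nabla\varphi_n\to G$ in $L^2$. Let $v=v(t,x)$ be a vector field in $L^2(\mathbb{R}_+,\dot H^1(\mathbb{R}^3)^3)$, that is, a measurable vector field on $\mathbb{R}_+\times\mathbb{R}^3$ with $v(t)\in \dot H^1(\mathbb{R}^3)^3$ for almost every $t>0$ and $\nabla v\in L^2(\mathbb{R}_+\times\mathbb{R}^3)$. Assume that $v$ is divergence free: $\nabla\cdot v(t)=0$ in the sense of distributions on $\mathbb{R}^3$ for almost every $t>0$. Let $a\in L^2(\mathbb{R}_+\times\mathbb{R}^3)$ be a real-valued distributional solution of the Cauchy problem $$\partial_t a+\nabla\cdot(av)-\Delta a=0,\qquad a(0)=0,$$ that is, $$\int_0^\infty\!\!\int_{\mathbb{R}^3}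 a\,\big(\partial_t\varphi+v\cdot\nabla\varphi+\Delta\varphi\big)\,dx\,dt=0\qquad\text{for every }\varphi\in C_c^\infty(\mathbb{R}\times\mathbb{R}^3).$$ Then $a=0$ almost everywhere on $\mathbb{R}_+\times\mathbb{R}^3$. -/

import Mathlib

open MeasureTheory Filter Topology Set
open scoped ENNReal ContDiff

namespace TransportDiffusion

/-- The physical space `ℝ³` with its Euclidean norm. -/
abbrev E3 : Type := EuclideanSpace ℝ (Fin 3)

/-- Lebesgue measure on `ℝ₊ × ℝ³`, seen as a measure on `ℝ × ℝ³`. -/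
noncomputable def spaceTime : Measure (ℝ × E3) :=
  ((volume : Measure ℝ).restrict (Ioi 0)).prod (volume : Measure E3)

/-- A test function on `X`: smooth with compact support, with values in `Y`. -/
def IsTest {X Y : Type*} [NormedAddCommGroup X] [NormedSpace ℝ X]
    [NormedAddCommGroup Y] [NormedSpace ℝ Y] (φ : X → Y) : Prop :=
  ContDiff ℝ ∞ φ ∧ HasCompactSupport φ

/-- `u` belongs to the homogeneous Sobolev space `Ḣ¹(ℝ³)` (with values in `ℝ³`), and `G j` is its
partial derivative `∂_j u`. The space `Ḣ¹(ℝ³)` is the completion of `C_c^∞(ℝ³)` for the norm `‖∇φ‖_{L²}`, realised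
as a space of locally integrable functions: there are test functions `φ n` converging to `u` in
`L¹_loc` such that `∂_j (φ n)` converges to `G j` in `L²` for each `j`. (Non-zero constants do not belong to it.) -/
structure HasGradientInL2 (u : E3 → E3) (G : Fin 3 → E3 → E3) : Prop where
  locallyIntegrable : LocallyIntegrable u volume
  memLp_gradient : ∀ j, MemLp (G j) 2 volume
  approx : ∃ φ : ℕ → E3 → E3, (∀ n, IsTest (φ n)) ∧
    (∀ j, Tendsto (fun n => eLpNorm
      (fun x => fderiv ℝ (φ n) x (EuclideanSpace.single j 1) - G j x) 2 volume) atTop (𝓝 0)) ∧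
    ∀ K : Set E3, IsCompact K →
      Tendsto (fun n => ∫⁻ x in K, ‖φ n x - u x‖ₑ) atTop (𝓝 0)

/-- The vector field `v` belongs to `L²(ℝ₊, Ḣ¹(ℝ³))`: it is measurable, `v(t) ∈ Ḣ¹(ℝ³)` for almost
every `t > 0`, and its space gradient is square integrable on `ℝ₊ × ℝ³`. -/
def MemL2HomSobolev (v : ℝ × E3 → E3) : Prop :=
  AEStronglyMeasurable v spaceTime ∧
    ∃ Dv : Fin 3 → ℝ × E3 → E3, (∀ j, MemLp (Dv j) 2 spaceTime) ∧
      ∀ᵐ t ∂((volume : Measure ℝ).restrict (Ioi 0)),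
        HasGradientInL2 (fun x => v (t, x)) (fun j x => Dv j (t, x))

/-- `∇ · v(t) = 0` in the sense of distributions on `ℝ³`, for almost every `t > 0`. -/
def IsDivergenceFree (v : ℝ × E3 → E3) : Prop :=
  ∀ᵐ t ∂((volume : Measure ℝ).restrict (Ioi 0)),
    ∀ ψ : E3 → ℝ, IsTest ψ → ∫ x, inner ℝ (v (t, x)) (gradient ψ x) = 0

/-- `a` is a distributional solution on `ℝ₊ × ℝ³` of the Cauchy problem
`∂ₜ a + ∇ · (a v) - Δ a = 0`, `a(0) = a₀`. The test functions are smooth with compact support in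
`ℝ × ℝ³`; they need not vanish near `t = 0`, so the identity encodes the initial condition too.
When `a` is in `L²(ℝ₊ × ℝ³)` and `v` in `L²(ℝ₊, Ḣ¹(ℝ³))`, the space-time integrand is
integrable. -/
def IsDistributionalSolution (v : ℝ × E3 → E3) (a : ℝ × E3 → ℝ) (a₀ : E3 → ℝ) : Prop :=
  ∀ φ : ℝ × E3 → ℝ, IsTest φ →
    ∫ z, a z * (deriv (fun s => φ (s, z.2)) z.1
        + inner ℝ (v z) (gradient (fun x => φ (z.1, x)) z.2)
        + Laplacian.laplacian (fun x => φ (z.1, x)) z.2) ∂spaceTime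
      + ∫ x, a₀ x * φ (0, x) = 0

end TransportDiffusion

namespace TransportDiffusion

/-! The proof is a DiPerna–Lions renormalization. Let `aₙ = ρₙ ⋆ a` be the mollification in space.
Then `∂ₜ aₙ + v · ∇aₙ - Δaₙ = rₙ`, where `rₙ(x) = ∫ a(y) ∇ρₙ(x - y) · (v(x) - v(y)) dy` is the
`commutator` (`source_eq`). Translations satisfy `‖v - v(· - h)‖₂ ≤ C |h| ‖∇v‖₂`, and the moment `∫
|h| |∇ρₙ(h)| dh` does not depend on `n`, so `‖rₙ(t)‖₁ ≤ C ‖a(t)‖₂ ‖∇v(t)‖₂` uniformly in `n`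
(`lintegral_commutator_le`). For smooth data the limit of `rₙ` is `-a ∇ · v`; by density and the
divergence condition `rₙ(t) → 0` in `L¹` (`tendsto_lintegral_commutator`), hence also in `L¹` of
space-time (`tendsto_commMass`).

Since `rₙ` is only controlled in `L¹`, the equation is multiplied by `β'(aₙ)` with `β'` bounded
rather than by `aₙ`. The function `β(s) = √(1 + s²) - 1` (`renorm`) is convex, so diffusion has a
sign; it has `|β'| ≤ 1`, and `β(s) ≤ min(|s|, s²)`. Testing with a cutoff `χ` gives, at almost every
time, a bound of `∫ χ β(aₙ)` by the mass of `rₙ` plus a flux term in `∇χ` and a term in `Δχ`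
(`ofReal_integral_source_le`).

For cutoffs `χⱼ` at scale `j + 1`, `Δχⱼ` is of order `j⁻²` while `β(aₙ) ≤ aₙ²` is integrable. The
norm `‖∇χⱼ‖₃` is scale invariant, so the embedding of `Ḣ¹` in `L⁶` bounds `|∇χⱼ| v` in `L²`; this
tends to zero because `v(t)` is a limit of compactly supported fields in the gradient norm. This is
where nonzero constant drifts are excluded. It remains that `∫ β(aₙ(t)) ≤ ‖rₙ‖_{L¹(ℝ₊ × ℝ³)}`, and
`n → ∞` with Fatou's lemma gives `β(a(t)) = 0`. No Gronwall argument is needed.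

In time, `t ↦ aₙ(t, x)` is for each fixed `x` a weak primitive of an integrable source vanishing for
`t ≤ 0` (`ae_eq_integral_of_weak`), so the renormalization in time is the chain rule for absolutely
continuous functions (`renorm_integral_eq`). -/

/-- The partial derivative `∂_i φ`. -/
noncomputable def partialDeriv {F : Type*} [NormedAddCommGroup F] [NormedSpace ℝ F]
    (i : Fin 3) (φ : E3 → F) (x : E3) : F :=
  fderiv ℝ φ x (EuclideanSpace.single i 1)

/-! ### Partial derivatives, integration by parts and mollification on `ℝ³` -/

section Calculus

variable {F : Type*} [NormedAddCommGroup F] [NormedSpace ℝ F]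

lemma contDiff_partialDeriv {φ : E3 → F} (h : ContDiff ℝ ∞ φ) (i : Fin 3) :
    ContDiff ℝ ∞ (partialDeriv i φ) :=
  (h.fderiv_right (m := ∞) (by simp)).clm_apply contDiff_const

lemma IsTest.partialDeriv {φ : E3 → F} (h : IsTest φ) (i : Fin 3) :
    IsTest (partialDeriv i φ) :=
  ⟨contDiff_partialDeriv h.1 i, h.2.fderiv_apply ℝ _⟩

lemma IsTest.continuous {φ : E3 → F} (h : IsTest φ) : Continuous φ := h.1.continuous

lemma IsTest.memLp {φ : E3 → F} (h : IsTest φ) (p : ℝ≥0∞) : MemLp φ p volume :=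
  h.continuous.memLp_of_hasCompactSupport h.2

lemma sum_smul_single (h : E3) : ∑ i, h i • (EuclideanSpace.single i (1 : ℝ) : E3) = h := by
  simpa using (EuclideanSpace.basisFun (Fin 3) ℝ).sum_repr h

lemma fderiv_eq_sum_partialDeriv (φ : E3 → F) (x h : E3) :
    fderiv ℝ φ x h = ∑ i, h i • partialDeriv i φ x := by
  conv_lhs => rw [← sum_smul_single h]
  simp [partialDeriv]

lemma norm_coord_le (h : E3) (i : Fin 3) : ‖h i‖ ≤ ‖h‖ := PiLp.norm_apply_le h i

lemma norm_fderiv_apply_le_sum (φ : E3 → F) (x h : E3) :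
    ‖fderiv ℝ φ x h‖ ≤ ‖h‖ * ∑ i, ‖partialDeriv i φ x‖ := by
  rw [fderiv_eq_sum_partialDeriv, Finset.mul_sum]
  refine (norm_sum_le _ _).trans (Finset.sum_le_sum fun i _ => ?_)
  rw [norm_smul]
  gcongr
  exact norm_coord_le h i

lemma norm_fderiv_le_sum (φ : E3 → F) (x : E3) :
    ‖fderiv ℝ φ x‖ ≤ ∑ i, ‖partialDeriv i φ x‖ :=
  ContinuousLinearMap.opNorm_le_bound _ (by positivity) fun h => by
    rw [mul_comm]; exact norm_fderiv_apply_le_sum φ x h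

lemma laplacian_eq_sum_partialDeriv {φ : E3 → ℝ} (h : ContDiff ℝ 2 φ) (x : E3) :
    Laplacian.laplacian φ x = ∑ i, partialDeriv i (partialDeriv i φ) x := by
  rw [InnerProductSpace.laplacian_eq_iteratedFDeriv_orthonormalBasis φ
    (EuclideanSpace.basisFun (Fin 3) ℝ)]
  refine Finset.sum_congr rfl fun i _ => ?_
  rw [iteratedFDeriv_two_apply]
  simp only [EuclideanSpace.basisFun_apply, Matrix.cons_val_zero, Matrix.cons_val_one]
  unfold partialDeriv
  rw [fderiv_clm_apply ((h.fderiv_right (m := 1) (by norm_num)).differentiable (by norm_num) x)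
    (differentiableAt_const _)]
  simp

lemma inner_gradient_eq_sum (w : E3) (φ : E3 → ℝ) (x : E3) :
    inner ℝ w (gradient φ x) = ∑ i, w i * partialDeriv i φ x := by
  rw [real_inner_comm, gradient, InnerProductSpace.toDual_symm_apply, fderiv_eq_sum_partialDeriv]
  simp

lemma integral_mul_partialDeriv {f g : E3 → ℝ} (hf : ContDiff ℝ 1 f) (hg : ContDiff ℝ 1 g)
    (hgs : HasCompactSupport g) (i : Fin 3) :
    ∫ x, f x * partialDeriv i g x = - ∫ x, partialDeriv i f x * g x := by
  have hf' : Continuous (fun x => fderiv ℝ f x (EuclideanSpace.single i (1 : ℝ))) :=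
    (hf.continuous_fderiv (by norm_num)).clm_apply continuous_const
  have hg' : Continuous (fun x => fderiv ℝ g x (EuclideanSpace.single i (1 : ℝ))) :=
    (hg.continuous_fderiv (by norm_num)).clm_apply continuous_const
  exact integral_mul_fderiv_eq_neg_fderiv_mul_of_integrable
    ((hf'.mul hg.continuous).integrable_of_hasCompactSupport hgs.mul_left)
    ((hf.continuous.mul hg').integrable_of_hasCompactSupport (hgs.fderiv_apply ℝ _).mul_left)
    ((hf.continuous.mul hg.continuous).integrable_of_hasCompactSupport hgs.mul_left)
    (fun x _ => hf.differentiable (by norm_num) x) (fun x _ => hg.differentiable (by norm_num) x)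

lemma partialDeriv_mul {f g : E3 → ℝ} {x : E3} (hf : DifferentiableAt ℝ f x)
    (hg : DifferentiableAt ℝ g x) (i : Fin 3) :
    partialDeriv i (fun y => f y * g y) x = partialDeriv i f x * g x + f x * partialDeriv i g x := by
  unfold partialDeriv
  rw [fderiv_fun_mul hf hg]
  simp; ring

lemma partialDeriv_comp {β : ℝ → ℝ} {g : E3 → ℝ} {x : E3} (hβ : DifferentiableAt ℝ β (g x))
    (hg : DifferentiableAt ℝ g x) (i : Fin 3) :
    partialDeriv i (fun y => β (g y)) x = deriv β (g x) * partialDeriv i g x := by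
  unfold partialDeriv
  have := (hβ.hasDerivAt.comp_hasFDerivAt x hg.hasFDerivAt).fderiv
  rw [show (fun y => β (g y)) = β ∘ g from rfl, this]
  simp

lemma partialDeriv_const_sub_comp {k : E3 → F} (hk : Differentiable ℝ k) (z : E3) (i : Fin 3) (y : E3) :
    partialDeriv i (fun y => k (z - y)) y = - partialDeriv i k (z - y) := by
  unfold partialDeriv
  have h := (hk (z - y)).hasFDerivAt.comp y ((hasFDerivAt_id y).const_sub z)
  have h' : fderiv ℝ (fun y => k (z - y)) y = _ := h.fderiv
  rw [h']
  simp

lemma IsTest.comp_const_sub {k : E3 → F} (hk : IsTest k) (z : E3) :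
    IsTest (fun y => k (z - y)) :=
  ⟨hk.1.comp (contDiff_const.sub contDiff_id),
    hk.2.comp_homeomorph (Homeomorph.subLeft z)⟩

/-- The mollification `ρ ⋆ a` of `a`. -/
noncomputable def mollify (ρ a : E3 → ℝ) (x : E3) : ℝ := ∫ y, a y * ρ (x - y)

lemma mollify_eq_convolution (ρ a : E3 → ℝ) :
    mollify ρ a = convolution a ρ (ContinuousLinearMap.mul ℝ ℝ) volume := by
  ext x; simp [mollify, convolution_def]

lemma contDiff_mollify {ρ a : E3 → ℝ} (hρ : IsTest ρ) (ha : LocallyIntegrable a volume) :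
    ContDiff ℝ ∞ (mollify ρ a) := by
  rw [mollify_eq_convolution]
  exact hρ.2.contDiff_convolution_right _ ha hρ.1

lemma partialDeriv_mollify {ρ a : E3 → ℝ} (hρ : IsTest ρ) (ha : LocallyIntegrable a volume)
    (i : Fin 3) : partialDeriv i (mollify ρ a) = mollify (partialDeriv i ρ) a := by
  ext x
  have h := hρ.2.hasFDerivAt_convolution_right (ContinuousLinearMap.mul ℝ ℝ) ha
    (hρ.1.of_le (by simp)) x
  rw [partialDeriv, mollify_eq_convolution, h.fderiv,
    convolution_precompR_apply _ ha (hρ.2.fderiv ℝ)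
      (hρ.1.continuous_fderiv (by simp))]
  simp [mollify, convolution_def, partialDeriv]

end Calculus

/-! ### Cauchy–Schwarz and Jensen for the `L²` norm -/

section SquareNorm

variable {α F F' : Type*} [MeasurableSpace α] {μ : Measure α} [NormedAddCommGroup F]
  [NormedAddCommGroup F']

lemma eLpNorm_two_sq (f : α → F) : eLpNorm f 2 μ ^ 2 = ∫⁻ x, ‖f x‖ₑ ^ 2 ∂μ := by
  have := eLpNorm_nnreal_pow_eq_lintegral (μ := μ) (f := f) (p := 2) (by norm_num)
  simpa using this

lemma lintegral_enorm_mul_enorm_le {f : α → F} {g : α → F'} (hf : AEStronglyMeasurable f μ)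
    (hg : AEStronglyMeasurable g μ) :
    ∫⁻ x, ‖f x‖ₑ * ‖g x‖ₑ ∂μ ≤ eLpNorm f 2 μ * eLpNorm g 2 μ := by
  have := ENNReal.lintegral_mul_le_Lp_mul_Lq μ (p := 2) (q := 2)
    Real.HolderConjugate.two_two hf.enorm hg.enorm
  simpa [eLpNorm_eq_lintegral_rpow_enorm_toReal] using this

/-- Jensen's inequality for the square. It is applied to Lebesgue measure on `(0, 1]` for
translations, and to the measure with density `mollifier n` for mollification. -/
lemma lintegral_sq_le_lintegral_sq [IsProbabilityMeasure μ] {f : α → F}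
    (hf : AEStronglyMeasurable f μ) : (∫⁻ x, ‖f x‖ₑ ∂μ) ^ 2 ≤ ∫⁻ x, ‖f x‖ₑ ^ 2 ∂μ := by
  rw [← eLpNorm_two_sq, ← eLpNorm_one_eq_lintegral_enorm]
  gcongr
  exact eLpNorm_le_eLpNorm_of_exponent_le (by norm_num) hf

end SquareNorm

/-! ### The homogeneous Sobolev space: density, Sobolev and translation inequalities, trace of the
gradient -/

section HomogeneousSobolev

/-- The sum of the `L²` norms of the partial derivatives. -/
noncomputable def gradNorm (G : Fin 3 → E3 → E3) : ℝ≥0∞ := ∑ j, eLpNorm (G j) 2 volume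

variable {u : E3 → E3} {G : Fin 3 → E3 → E3}

lemma HasGradientInL2.gradNorm_ne_top (h : HasGradientInL2 u G) : gradNorm G ≠ ⊤ :=
  (ENNReal.sum_lt_top.2 fun j _ => (h.memLp_gradient j).2).ne

lemma HasGradientInL2.sub_test (h : HasGradientInL2 u G) {φ : E3 → E3} (hφ : IsTest φ) :
    HasGradientInL2 (u - φ) (fun j => G j - partialDeriv j φ) where
  locallyIntegrable := h.locallyIntegrable.sub hφ.continuous.locallyIntegrable
  memLp_gradient j := (h.memLp_gradient j).sub ((hφ.partialDeriv j).memLp 2)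
  approx := by
    obtain ⟨ψ, hψ, hG, hu⟩ := h.approx
    refine ⟨fun n => ψ n - φ, fun n => ⟨(hψ n).1.sub hφ.1, (hψ n).2.sub hφ.2⟩, fun j => ?_,
      fun K hK => ?_⟩
    · convert hG j using 4 with n
      rename_i x
      rw [fderiv_sub ((hψ n).1.differentiable (by simp) x) (hφ.1.differentiable (by simp) x)]
      simp [partialDeriv]
    · simpa using hu K hK

/-- Only the gradients need be close: every later bound on `u - φ` involves its gradient alone. -/
lemma HasGradientInL2.exists_gradNorm_sub_le (h : HasGradientInL2 u G) {δ : ℝ≥0∞} (hδ : δ ≠ 0) :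
    ∃ φ : E3 → E3, IsTest φ ∧ gradNorm (fun j => G j - partialDeriv j φ) ≤ δ := by
  obtain ⟨φ, hφ, hG, -⟩ := h.approx
  have : Tendsto (fun n => gradNorm (fun j => G j - partialDeriv j (φ n)))
      atTop (𝓝 0) := by
    have := tendsto_finsetSum Finset.univ (fun j _ => hG j)
    simp only [Finset.sum_const_zero] at this
    convert this using 2 with n
    exact Finset.sum_congr rfl fun j _ =>
      eLpNorm_sub_comm (G j) (partialDeriv j (φ n)) 2 volume
  obtain ⟨n, hn⟩ := ((ENNReal.tendsto_nhds_zero.1 this) δ hδ.bot_lt).exists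
  exact ⟨φ n, hφ n, hn⟩

lemma ae_tendsto_of_tsum_lintegral_ne_top {α F : Type*} [MeasurableSpace α] {μ : Measure α}
    [NormedAddCommGroup F] {f : ℕ → α → F} {g : α → F}
    (hf : ∀ n, AEStronglyMeasurable (f n) μ) (hg : AEStronglyMeasurable g μ)
    (h : ∑' n, ∫⁻ x, ‖f n x - g x‖ₑ ∂μ ≠ ⊤) :
    ∀ᵐ x ∂μ, Tendsto (fun n => f n x) atTop (𝓝 (g x)) := by
  have hm : ∀ n, AEMeasurable (fun x => ‖f n x - g x‖ₑ) μ := fun n => ((hf n).sub hg).enorm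
  rw [← lintegral_tsum hm] at h
  filter_upwards [ae_lt_top' (AEMeasurable.tsum hm) h]
    with x hx
  have := ENNReal.tendsto_atTop_zero_of_tsum_ne_top hx.ne
  rw [tendsto_iff_edist_tendsto_0]
  simpa [edist_eq_enorm_sub] using this

/-- Choosing an approximation with error `2⁻ⁿ` on the ball of radius `n` makes the `L¹` errors
summable on each fixed ball, which upgrades `L¹_loc` convergence to convergence almost everywhere,
the form that Fatou's lemma requires. -/
lemma HasGradientInL2.exists_ae_approx (h : HasGradientInL2 u G) :
    ∃ φ : ℕ → E3 → E3, (∀ n, IsTest (φ n)) ∧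
      (∀ j, Tendsto (fun n => eLpNorm (partialDeriv j (φ n) - G j) 2 volume)
        atTop (𝓝 0)) ∧
      ∀ᵐ x, Tendsto (fun n => φ n x) atTop (𝓝 (u x)) := by
  obtain ⟨φ, hφ, hG, hu⟩ := h.approx
  have key : ∀ n : ℕ, ∃ m, n ≤ m ∧
      ∫⁻ x in Metric.closedBall (0 : E3) n, ‖φ m x - u x‖ₑ ≤ (2⁻¹ : ℝ≥0∞) ^ n := fun n => by
    have := (ENNReal.tendsto_nhds_zero.1 (hu _ (isCompact_closedBall (0 : E3) n)))
      ((2⁻¹ : ℝ≥0∞) ^ n) (ENNReal.pow_pos (by simp) n)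
    obtain ⟨m, h1, h2⟩ := (this.and (eventually_ge_atTop n)).exists
    exact ⟨m, h2, h1⟩
  choose m hm hmu using key
  have hmt : Tendsto m atTop atTop := tendsto_atTop_mono hm tendsto_id
  refine ⟨fun n => φ (m n), fun n => hφ _, fun j => (hG j).comp hmt, ?_⟩
  have hR : ∀ R : ℕ, ∀ᵐ x, x ∈ Metric.closedBall (0 : E3) R →
      Tendsto (fun n => φ (m n) x) atTop (𝓝 (u x)) := fun R => by
    rw [← ae_restrict_iff' Metric.isClosed_closedBall.measurableSet]
    -- The ball of radius `n` contains that of radius `R` only from `n = R` on, hence the shift of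
    -- the index.
    have hshift : ∀ᵐ x ∂(volume.restrict (Metric.closedBall (0 : E3) R)),
        Tendsto (fun n => φ (m (n + R)) x) atTop (𝓝 (u x)) := by
      refine ae_tendsto_of_tsum_lintegral_ne_top
        (fun n => (hφ _).continuous.aestronglyMeasurable)
        h.locallyIntegrable.aestronglyMeasurable.restrict ?_
      refine ne_top_of_le_ne_top (b := ∑' n : ℕ, (2⁻¹ : ℝ≥0∞) ^ n)
        (by rw [ENNReal.tsum_geometric]; simp) (ENNReal.tsum_le_tsum fun n => ?_)
      calc _ ≤ ∫⁻ x in Metric.closedBall (0 : E3) ↑(n + R), ‖φ (m (n + R)) x - u x‖ₑ :=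
            lintegral_mono_set (Metric.closedBall_subset_closedBall (by simp))
        _ ≤ (2⁻¹ : ℝ≥0∞) ^ (n + R) := hmu _
        _ ≤ _ := pow_le_pow_right_of_le_one' (by simp) (by simp)
    filter_upwards [hshift] with x hx
    exact (tendsto_add_atTop_iff_nat R).1 hx
  filter_upwards [ae_all_iff.2 hR] with x hx
  obtain ⟨R, hR'⟩ := exists_nat_ge ‖x‖
  exact hx R (by simpa using hR')

/-- An `L²` bound by the gradient passes from test functions to the homogeneous Sobolev space. -/
lemma HasGradientInL2.eLpNorm_le_of_test (h : HasGradientInL2 u G) (T : (E3 → E3) → E3 → E3)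
    {C : ℝ≥0∞} (hC : C ≠ ⊤)
    (hT : ∀ φ, IsTest φ → AEStronglyMeasurable (T φ) volume ∧ eLpNorm (T φ) 2 volume ≤
      C * gradNorm (fun j => partialDeriv j φ))
    (hlim : ∀ φ : ℕ → E3 → E3, (∀ᵐ x, Tendsto (fun n => φ n x) atTop (𝓝 (u x))) →
      ∀ᵐ x, Tendsto (fun n => T (φ n) x) atTop (𝓝 (T u x))) :
    eLpNorm (T u) 2 volume ≤ C * gradNorm G := by
  obtain ⟨φ, hφ, hG, hu⟩ := h.exists_ae_approx
  -- Lower semicontinuity of the `L²` norm under almost everywhere convergence.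
  refine (Lp.eLpNorm_lim_le_liminf_eLpNorm (fun n => (hT _ (hφ n)).1) _ (hlim φ hu)).trans ?_
  have hb : ∀ n, eLpNorm (T (φ n)) 2 volume ≤ C * ∑ j,
      (eLpNorm (partialDeriv j (φ n) - G j) 2 volume
        + eLpNorm (G j) 2 volume) := fun n => by
    refine (hT _ (hφ n)).2.trans ?_
    unfold gradNorm
    gcongr with j
    have := eLpNorm_add_le (p := 2) (μ := volume)
      ((((hφ n).partialDeriv j).memLp 2).1.sub (h.memLp_gradient j).1) (h.memLp_gradient j).1
      (by norm_num)
    simpa using this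
  have ht : Tendsto (fun n => C * ∑ j,
      (eLpNorm (partialDeriv j (φ n) - G j) 2 volume
        + eLpNorm (G j) 2 volume)) atTop (𝓝 (C * gradNorm G)) := by
    refine ENNReal.Tendsto.const_mul ?_ (Or.inr hC)
    have := tendsto_finsetSum Finset.univ
      (fun j _ => (hG j).add_const (eLpNorm (G j) 2 volume))
    simpa [gradNorm] using this
  rw [← ht.liminf_eq]
  exact liminf_le_liminf (Eventually.of_forall hb)

/-- The constant in the weighted inequality. -/
noncomputable def sobolevConst : ℝ≥0∞ := SNormLESNormFDerivOfEqConst E3 (volume : Measure E3) 2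

lemma sobolevConst_ne_top : sobolevConst ≠ ⊤ := ENNReal.coe_ne_top

lemma eLpNorm_fderiv_le_gradNorm {φ : E3 → E3} (hφ : IsTest φ) :
    eLpNorm (fderiv ℝ φ) 2 volume ≤ gradNorm (fun j => partialDeriv j φ) := by
  calc eLpNorm (fderiv ℝ φ) 2 volume
      ≤ eLpNorm (∑ j, fun x => ‖partialDeriv j φ x‖) 2 volume :=
        eLpNorm_mono_real fun x => by simpa using norm_fderiv_le_sum φ x
    _ ≤ ∑ j, eLpNorm (fun x => ‖partialDeriv j φ x‖) 2 volume :=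
        eLpNorm_sum_le (fun j _ => (hφ.partialDeriv j).continuous.norm.aestronglyMeasurable)
          (by norm_num)
    _ = _ := by simp [gradNorm, eLpNorm_norm]

/-- The Gagliardo–Nirenberg–Sobolev inequality in dimension three, where `1/6 = 1/2 - 1/3`. -/
lemma eLpNorm_six_le_gradNorm {φ : E3 → E3} (hφ : IsTest φ) :
    eLpNorm φ 6 volume ≤ sobolevConst * gradNorm (fun j => partialDeriv j φ) := by
  have := eLpNorm_le_eLpNorm_fderiv_of_eq (μ := (volume : Measure E3)) (p := 2) (p' := 6)
    (hφ.1.of_le (by simp)) hφ.2 (by norm_num) (by simp) (by simp; norm_num)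
  refine (by simpa using this : eLpNorm φ 6 volume ≤ _).trans ?_
  exact mul_le_mul' le_rfl (eLpNorm_fderiv_le_gradNorm hφ)

instance holderTriple_three_six_two : ENNReal.HolderTriple 3 6 2 where
  inv_add_inv_eq_inv := by
    rw [← ENNReal.toReal_eq_toReal_iff' (by simp) (by simp), ENNReal.toReal_add (by simp) (by simp)]
    simp; norm_num

/-- The weighted Sobolev inequality `‖k u‖₂ ≤ C ‖k‖₃ ‖∇u‖₂`. -/
lemma HasGradientInL2.eLpNorm_smul_le (h : HasGradientInL2 u G) {k : E3 → ℝ}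
    (hk : MemLp k 3 volume) :
    eLpNorm (fun x => k x • u x) 2 volume
      ≤ sobolevConst * eLpNorm k 3 volume * gradNorm G := by
  refine h.eLpNorm_le_of_test (fun w x => k x • w x)
    (ENNReal.mul_ne_top sobolevConst_ne_top hk.2.ne) (fun φ hφ => ⟨?_, ?_⟩) (fun φ hφ => ?_)
  · exact hk.1.smul hφ.continuous.aestronglyMeasurable
  · refine (eLpNorm_smul_le_mul_eLpNorm (p := 3) (q := 6) (r := 2)
      hφ.continuous.aestronglyMeasurable hk.1).trans ?_
    rw [mul_comm sobolevConst, mul_assoc]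
    exact mul_le_mul' le_rfl (eLpNorm_six_le_gradNorm hφ)
  · filter_upwards [hφ] with x hx using hx.const_smul _

lemma HasGradientInL2.memLp_smul (h : HasGradientInL2 u G) {k : E3 → ℝ}
    (hk : MemLp k 3 volume) : MemLp (fun x => k x • u x) 2 volume :=
  ⟨hk.1.smul h.locallyIntegrable.aestronglyMeasurable, (h.eLpNorm_smul_le hk).trans_lt
    (ENNReal.mul_lt_top (ENNReal.mul_lt_top sobolevConst_ne_top.lt_top hk.2)
      h.gradNorm_ne_top.lt_top)⟩

lemma sub_translate_eq_integral {φ : E3 → E3} (hφ : IsTest φ) (x h : E3) :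
    φ x - φ (x - h) = ∫ s in (0 : ℝ)..1, fderiv ℝ φ (x - s • h) h := by
  have hd : ∀ s : ℝ, HasDerivAt (fun s : ℝ => - φ (x - s • h)) (fderiv ℝ φ (x - s • h) h) s := by
    intro s
    have h1 : HasDerivAt (fun s : ℝ => x - s • h) (-h) s := by
      simpa using ((hasDerivAt_id s).smul_const h).const_sub x
    have h2 := ((hφ.1.differentiable (by simp) (x - s • h)).hasFDerivAt.comp_hasDerivAt s h1).neg
    simp only [map_neg, neg_neg] at h2
    exact h2
  rw [intervalIntegral.integral_eq_sub_of_hasDerivAt (fun s _ => hd s)]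
  · simp; abel
  · refine Continuous.intervalIntegrable ?_ _ _
    exact ((hφ.1.continuous_fderiv (by simp)).comp (by fun_prop)).clm_apply continuous_const

/-- The increment is the average over `s ∈ (0, 1]` of `Dφ(x - s h) h`. Jensen in `s`, Tonelli and
translation invariance bound its `L²` norm by that of `Dφ · h`. -/
lemma eLpNorm_sub_translate_le_of_test {φ : E3 → E3} (hφ : IsTest φ) (h : E3) :
    eLpNorm (fun x => φ x - φ (x - h)) 2 volume
      ≤ ‖h‖ₑ * gradNorm (fun j => partialDeriv j φ) := by
  have hc : Continuous (fun p : E3 × ℝ => fderiv ℝ φ (p.1 - p.2 • h) h) :=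
    ((hφ.1.continuous_fderiv (by simp)).comp (by fun_prop)).clm_apply continuous_const
  have hprob : IsProbabilityMeasure (volume.restrict (Ioc (0 : ℝ) 1)) := ⟨by simp⟩
  have key : eLpNorm (fun x => φ x - φ (x - h)) 2 volume
      ≤ eLpNorm (fun x => fderiv ℝ φ x h) 2 volume := by
    rw [← ENNReal.pow_le_pow_left_iff (n := 2) (by norm_num), eLpNorm_two_sq, eLpNorm_two_sq]
    calc ∫⁻ x, ‖φ x - φ (x - h)‖ₑ ^ 2
        ≤ ∫⁻ x, ∫⁻ s in Ioc (0 : ℝ) 1, ‖fderiv ℝ φ (x - s • h) h‖ₑ ^ 2 := by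
          refine lintegral_mono fun x => ?_
          rw [sub_translate_eq_integral hφ, intervalIntegral.integral_of_le zero_le_one]
          have hx : AEStronglyMeasurable (fun s : ℝ => fderiv ℝ φ (x - s • h) h)
              (volume.restrict (Ioc (0 : ℝ) 1)) :=
            (hc.comp (by fun_prop : Continuous fun s : ℝ => (x, s))).aestronglyMeasurable
          exact (pow_le_pow_left' (enorm_integral_le_lintegral_enorm _) 2).trans
            (lintegral_sq_le_lintegral_sq hx)
      _ = ∫⁻ s in Ioc (0 : ℝ) 1, ∫⁻ x, ‖fderiv ℝ φ (x - s • h) h‖ₑ ^ 2 :=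
          lintegral_lintegral_swap (hc.enorm.measurable.pow_const 2).aemeasurable
      _ = ∫⁻ s in Ioc (0 : ℝ) 1, ∫⁻ x, ‖fderiv ℝ φ x h‖ₑ ^ 2 := by
          congr with s
          exact lintegral_sub_right_eq_self (fun x => ‖fderiv ℝ φ x h‖ₑ ^ 2) (s • h)
      _ = _ := by simp
  refine key.trans ?_
  calc eLpNorm (fun x => fderiv ℝ φ x h) 2 volume
      ≤ ENNReal.ofReal ‖h‖ * eLpNorm (fderiv ℝ φ) 2 volume :=
        eLpNorm_le_mul_eLpNorm_of_ae_le_mul (ae_of_all _ fun x => by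
          rw [mul_comm]; exact (fderiv ℝ φ x).le_opNorm h) 2
    _ ≤ _ := by
        rw [ofReal_norm]
        exact mul_le_mul' le_rfl (eLpNorm_fderiv_le_gradNorm hφ)

lemma HasGradientInL2.eLpNorm_sub_translate_le (hu : HasGradientInL2 u G) (h : E3) :
    eLpNorm (fun x => u x - u (x - h)) 2 volume ≤ ‖h‖ₑ * gradNorm G := by
  refine hu.eLpNorm_le_of_test (fun w x => w x - w (x - h)) (by simp)
    (fun φ hφ => ⟨?_, eLpNorm_sub_translate_le_of_test hφ h⟩) (fun φ hφ => ?_)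
  · exact (hφ.continuous.sub (hφ.continuous.comp (by fun_prop))).aestronglyMeasurable
  · filter_upwards [hφ, (measurePreserving_sub_right volume h).quasiMeasurePreserving.ae hφ]
      with x hx hx' using hx.sub hx'

lemma partialDeriv_coord {φ : E3 → E3} (hφ : IsTest φ) (i j : Fin 3) (x : E3) :
    partialDeriv i (fun y => φ y j) x = partialDeriv i φ x j := by
  have h := ((EuclideanSpace.proj (𝕜 := ℝ) j : E3 →L[ℝ] ℝ).hasFDerivAt.comp x
    (hφ.1.differentiable (by simp) x).hasFDerivAt).fderiv
  unfold partialDeriv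
  rw [show (fun y => φ y j) = (EuclideanSpace.proj (𝕜 := ℝ) j : E3 →L[ℝ] ℝ) ∘ φ from rfl, h]
  simp

lemma IsTest.coord {φ : E3 → E3} (hφ : IsTest φ) (j : Fin 3) : IsTest (fun y => φ y j) :=
  ⟨(EuclideanSpace.proj (𝕜 := ℝ) j : E3 →L[ℝ] ℝ).contDiff.comp hφ.1,
    hφ.2.comp_left (g := fun w : E3 => w j) (by simp)⟩

lemma continuous_gradient {ψ : E3 → ℝ} (hψ : ContDiff ℝ 1 ψ) : Continuous (gradient ψ) :=
  (InnerProductSpace.toDual ℝ E3).symm.continuous.comp (hψ.continuous_fderiv (by simp))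

lemma hasCompactSupport_gradient {ψ : E3 → ℝ} (hψ : HasCompactSupport ψ) :
    HasCompactSupport (gradient ψ) :=
  (hψ.fderiv ℝ).comp_left (g := (InnerProductSpace.toDual ℝ E3).symm) (by simp)

lemma integral_inner_gradient_of_test {φ : E3 → E3} (hφ : IsTest φ) {ψ : E3 → ℝ}
    (hψ : IsTest ψ) :
    ∫ x, inner ℝ (φ x) (gradient ψ x) = - ∫ x, (∑ i, partialDeriv i φ x i) * ψ x := by
  have h1 : ∀ i, Integrable (fun x => φ x i * partialDeriv i ψ x) volume := fun i =>
    ((hφ.coord i).continuous.mul (hψ.partialDeriv i).continuous).integrable_of_hasCompactSupport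
      (hψ.partialDeriv i).2.mul_left
  have h2 : ∀ i, Integrable (fun x => partialDeriv i (fun y => φ y i) x * ψ x) volume := fun i =>
    (((hφ.coord i).partialDeriv i).continuous.mul hψ.continuous).integrable_of_hasCompactSupport
      hψ.2.mul_left
  simp only [inner_gradient_eq_sum, Finset.sum_mul, ← partialDeriv_coord hφ]
  rw [integral_finsetSum _ fun i _ => h1 i, integral_finsetSum _ fun i _ => h2 i,
    ← Finset.sum_neg_distrib]
  exact Finset.sum_congr rfl fun i _ => integral_mul_partialDeriv
    ((hφ.coord i).1.of_le (by simp)) (hψ.1.of_le (by simp)) hψ.2 i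

/-- A divergence free field has a trace free gradient. -/
lemma HasGradientInL2.trace_eq_zero (h : HasGradientInL2 u G)
    (hdiv : ∀ ψ : E3 → ℝ, IsTest ψ → ∫ x, inner ℝ (u x) (gradient ψ x) = 0) :
    ∀ᵐ x, ∑ i, G i x i = 0 := by
  have hGi : ∀ i, MemLp (fun x => G i x i) 2 volume := fun i =>
    (h.memLp_gradient i).mono
      ((EuclideanSpace.proj (𝕜 := ℝ) i : E3 →L[ℝ] ℝ).continuous.comp_aestronglyMeasurable
        (h.memLp_gradient i).1) (ae_of_all _ fun x => norm_coord_le _ _)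
  refine ae_eq_zero_of_integral_contDiff_smul_eq_zero
    (MemLp.locallyIntegrable (memLp_finsetSum _ fun i _ => hGi i) (by norm_num))
    fun ψ hψ1 hψ2 => ?_
  have hψ : IsTest ψ := ⟨hψ1, hψ2⟩
  obtain ⟨φ, hφ, hG, hu⟩ := h.approx
  obtain ⟨M, hM⟩ := (continuous_gradient (hψ1.of_le (by simp))).bounded_above_of_compact_support
    (hasCompactSupport_gradient hψ2)
  have hK : IsCompact (tsupport (gradient ψ)) := hasCompactSupport_gradient hψ2
  have hgc : Continuous (gradient ψ) := continuous_gradient (hψ1.of_le (by simp))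
  have hul : Integrable (fun x => inner ℝ (u x) (gradient ψ x)) volume := by
    simp only [inner_gradient_eq_sum]
    refine integrable_finsetSum _ fun i _ => ?_
    have h1 : LocallyIntegrable (fun x => u x i) volume := fun x => by
      obtain ⟨s, hs, hi⟩ := h.locallyIntegrable x
      exact ⟨s, hs, (EuclideanSpace.proj (𝕜 := ℝ) i : E3 →L[ℝ] ℝ).integrable_comp hi⟩
    simpa [mul_comm] using h1.integrable_smul_left_of_hasCompactSupport
      (hψ.partialDeriv i).continuous (hψ.partialDeriv i).2
  -- The identity `∫ φₙ · ∇ψ = -∫ (∇ · φₙ) ψ` passes to the limit: the left side by `L¹` convergence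
  -- on the support of `∇ψ`, the right side by `L²` convergence of the gradients.
  have lim1 : Tendsto (fun n => ∫ x, inner ℝ (φ n x) (gradient ψ x)) atTop (𝓝 0) := by
    rw [← hdiv ψ hψ]
    refine tendsto_integral_of_L1 _ hul.1 (Eventually.of_forall fun n => ?_) ?_
    · exact ((hφ n).continuous.inner hgc).integrable_of_hasCompactSupport
        (HasCompactSupport.intro hK fun x hx => by
          simp [image_eq_zero_of_notMem_tsupport hx])
    · have hb : ∀ n, ∫⁻ x, ‖inner ℝ (φ n x) (gradient ψ x) - inner ℝ (u x) (gradient ψ x)‖ₑ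
          ≤ ENNReal.ofReal M * ∫⁻ x in tsupport (gradient ψ), ‖φ n x - u x‖ₑ := fun n => by
        rw [← lintegral_const_mul' _ _ (by simp), ← lintegral_indicator hK.measurableSet]
        refine lintegral_mono fun x => ?_
        by_cases hx : x ∈ tsupport (gradient ψ)
        · rw [indicator_of_mem hx, ← inner_sub_left, ← ofReal_norm, ← ofReal_norm,
            ← ENNReal.ofReal_mul' (norm_nonneg _)]
          refine ENNReal.ofReal_le_ofReal ?_
          rw [mul_comm]
          exact (norm_inner_le_norm _ _).trans (by gcongr; exact hM x)
        · simp [image_eq_zero_of_notMem_tsupport hx, hx]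
      refine tendsto_of_tendsto_of_tendsto_of_le_of_le tendsto_const_nhds ?_ (fun _ => zero_le)
        hb
      simpa using ENNReal.Tendsto.const_mul (hu _ hK) (Or.inr (by simp : ENNReal.ofReal M ≠ ⊤))
  have lim2 : Tendsto (fun n => ∫ x, (∑ i, partialDeriv i (φ n) x i) * ψ x)
      atTop (𝓝 (∫ x, (∑ i, G i x i) * ψ x)) := by
    have hint : ∀ n, ∀ i, MemLp (fun x => partialDeriv i (φ n) x i) 2 volume :=
      fun n i => (((hφ n).partialDeriv i).coord i).memLp 2
    refine tendsto_integral_of_L1 _ ?_ (Eventually.of_forall fun n => ?_) ?_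
    · exact ((memLp_finsetSum _ fun i _ => hGi i).integrable_mul (hψ.memLp 2)).1
    · exact (memLp_finsetSum _ fun i _ => hint n i).integrable_mul (hψ.memLp 2)
    · have hb : ∀ n, ∫⁻ x, ‖(∑ i, partialDeriv i (φ n) x i) * ψ x
            - (∑ i, G i x i) * ψ x‖ₑ
          ≤ (∑ i, eLpNorm (partialDeriv i (φ n) - G i) 2 volume)
            * eLpNorm ψ 2 volume := fun n => by
        have hm : ∀ i, AEStronglyMeasurable
            (fun x => partialDeriv i (φ n) x i - G i x i) volume :=
          fun i => (hint n i).1.sub (hGi i).1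
        calc _ = ∫⁻ x, ‖(∑ i, fun x => (partialDeriv i (φ n) x i - G i x i)) x‖ₑ
                * ‖ψ x‖ₑ := by
              refine lintegral_congr fun x => ?_
              rw [← enorm_mul]
              simp [Finset.sum_sub_distrib, sub_mul]
          _ ≤ _ := by
              refine (lintegral_enorm_mul_enorm_le
                (Finset.aestronglyMeasurable_sum _ fun i _ => hm i) (hψ.memLp 2).1).trans ?_
              gcongr
              refine (eLpNorm_sum_le (fun i _ => hm i) (by norm_num)).trans ?_
              gcongr with i
              exact eLpNorm_mono fun x => norm_coord_le
                (partialDeriv i (φ n) x - G i x) i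
      refine tendsto_of_tendsto_of_tendsto_of_le_of_le tendsto_const_nhds ?_ (fun _ => zero_le)
        hb
      have hG' : ∀ i, Tendsto (fun n =>
          eLpNorm (partialDeriv i (φ n) - G i) 2 volume) atTop (𝓝 0) := hG
      simpa using ENNReal.Tendsto.mul_const (tendsto_finsetSum Finset.univ fun i _ => hG' i)
        (Or.inr (hψ.memLp 2).2.ne)
  simp only [integral_inner_gradient_of_test (hφ _) hψ] at lim1
  have := tendsto_nhds_unique lim1 lim2.neg
  simp only [smul_eq_mul, mul_comm (ψ _)]
  linarith

end HomogeneousSobolev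

/-! ### Mollifiers and their scaling -/

section Mollifier

/-- A bump function concentrated at scale `1 / (n + 1)`. -/
noncomputable def bump (n : ℕ) : ContDiffBump (0 : E3) where
  rIn := 1 / (n + 1)
  rOut := 2 / (n + 1)
  rIn_pos := by positivity
  rIn_lt_rOut := by gcongr; norm_num

/-- A standard sequence of mollifiers. -/
noncomputable def mollifier (n : ℕ) : E3 → ℝ := (bump n).normed volume

lemma isTest_mollifier (n : ℕ) : IsTest (mollifier n) :=
  ⟨(bump n).contDiff_normed, (bump n).hasCompactSupport_normed⟩

lemma mollifier_nonneg (n : ℕ) (x : E3) : 0 ≤ mollifier n x := (bump n).nonneg_normed x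

lemma integral_mollifier (n : ℕ) : ∫ x, mollifier n x = 1 := (bump n).integral_normed

/-- The profile of a `ContDiffBump` depends only on the ratio of its radii, which is `2` for every
`n`; thus all the bumps are dilates of one function. -/
lemma bump_eq_bump_zero (n : ℕ) (x : E3) : bump n x = bump 0 (((n : ℝ) + 1) • x) := by
  have hn : (n : ℝ) + 1 ≠ 0 := by positivity
  rw [ContDiffBump.apply, ContDiffBump.apply]
  simp only [bump]
  have h1 : 2 / ((n : ℝ) + 1) / (1 / ((n : ℝ) + 1)) = 2 / (((0 : ℕ) : ℝ) + 1) /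
      (1 / (((0 : ℕ) : ℝ) + 1)) := by push_cast; field_simp
  rw [h1]
  simp

lemma mollifier_eq_mollifier_zero (n : ℕ) (x : E3) :
    mollifier n x = ((n : ℝ) + 1) ^ 3 * mollifier 0 (((n : ℝ) + 1) • x) := by
  have hn : (0 : ℝ) < (n : ℝ) + 1 := by positivity
  have h : ∫ x, bump n x = (((n : ℝ) + 1) ^ 3)⁻¹ * ∫ x, bump 0 x := by
    simp only [bump_eq_bump_zero n]
    rw [Measure.integral_comp_smul volume (fun x => bump 0 x)]
    simp [abs_of_pos hn]
  have h0 : 0 < ∫ x, bump 0 x := (bump 0).integral_pos (μ := volume)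
  unfold mollifier
  rw [ContDiffBump.normed_def, ContDiffBump.normed_def, h, bump_eq_bump_zero]
  field_simp

lemma fderiv_mollifier (n : ℕ) (x : E3) :
    fderiv ℝ (mollifier n) x
      = ((n : ℝ) + 1) ^ 4 • fderiv ℝ (mollifier 0) (((n : ℝ) + 1) • x) := by
  have hd : Differentiable ℝ (mollifier 0) := (isTest_mollifier 0).1.differentiable (by simp)
  have h1 : HasFDerivAt (fun x : E3 => ((n : ℝ) + 1) • x)
      (((n : ℝ) + 1) • ContinuousLinearMap.id ℝ E3) x :=
    (((n : ℝ) + 1) • ContinuousLinearMap.id ℝ E3).hasFDerivAt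
  have h := ((hd (((n : ℝ) + 1) • x)).hasFDerivAt.comp x h1).const_mul (((n : ℝ) + 1) ^ 3)
  rw [show mollifier n = _ from funext (mollifier_eq_mollifier_zero n)]
  rw [show (fun x => ((n : ℝ) + 1) ^ 3 * mollifier 0 (((n : ℝ) + 1) • x))
    = fun y => ((n : ℝ) + 1) ^ 3 * (mollifier 0 ∘ fun x => ((n : ℝ) + 1) • x) y from rfl, h.fderiv]
  ext y
  simp; ring

/-- The first absolute moment of the gradient of the mollifiers. -/
noncomputable def mollifierMoment : ℝ := ∫ h, ‖h‖ * ‖fderiv ℝ (mollifier 0) h‖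

lemma integrable_norm_mul_fderiv {ρ : E3 → ℝ} (hρ : IsTest ρ) :
    Integrable (fun h => ‖h‖ * ‖fderiv ℝ ρ h‖) volume :=
  (continuous_norm.mul (hρ.1.continuous_fderiv (by simp)).norm).integrable_of_hasCompactSupport
    (hρ.2.fderiv ℝ).norm.mul_left

/-- The gradient scales with the power `4` and `|h|` gives one power back, leaving exactly the
Jacobian of the dilation. This invariance makes the commutator bound uniform in `n`. -/
lemma integral_norm_mul_fderiv_mollifier (n : ℕ) :
    ∫ h, ‖h‖ * ‖fderiv ℝ (mollifier n) h‖ = mollifierMoment := by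
  have hn : (0 : ℝ) < (n : ℝ) + 1 := by positivity
  have : ∀ h : E3, ‖h‖ * ‖fderiv ℝ (mollifier n) h‖ = ((n : ℝ) + 1) ^ 3 *
      (fun h => ‖h‖ * ‖fderiv ℝ (mollifier 0) h‖) (((n : ℝ) + 1) • h) := fun h => by
    rw [fderiv_mollifier, norm_smul]
    simp only [norm_smul, norm_pow, Real.norm_of_nonneg hn.le]
    ring
  simp only [this]
  rw [integral_const_mul,
    Measure.integral_comp_smul volume (fun h : E3 => ‖h‖ * ‖fderiv ℝ (mollifier 0) h‖)]
  simp only [finrank_euclideanSpace, Fintype.card_fin, smul_eq_mul, mollifierMoment]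
  rw [abs_of_pos (by positivity)]
  field_simp

lemma lintegral_enorm_mul_fderiv_mollifier (n : ℕ) :
    ∫⁻ h, ‖fderiv ℝ (mollifier n) h‖ₑ * ‖h‖ₑ = ENNReal.ofReal mollifierMoment := by
  rw [← integral_norm_mul_fderiv_mollifier n, ofReal_integral_eq_lintegral_ofReal
    (integrable_norm_mul_fderiv (isTest_mollifier n)) (ae_of_all _ fun x => by positivity)]
  refine lintegral_congr fun h => ?_
  rw [ENNReal.ofReal_mul (norm_nonneg _), ofReal_norm, ofReal_norm, mul_comm]

lemma fderiv_mollifier_eq_zero {n : ℕ} {h : E3} (hh : 2 / ((n : ℝ) + 1) < ‖h‖) :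
    fderiv ℝ (mollifier n) h = 0 := by
  apply image_eq_zero_of_notMem_tsupport
  intro hc
  have := tsupport_fderiv_subset ℝ hc
  rw [mollifier, ContDiffBump.tsupport_normed_eq] at this
  simp only [bump, Metric.mem_closedBall, dist_zero_right] at this
  linarith

/-- Integration by parts together with `∫ ρₙ = 1`. With `L` the derivative of a field, this is how
the divergence enters the limit of the commutators. -/
lemma integral_fderiv_mollifier_apply (n : ℕ) (L : E3 →L[ℝ] E3) :
    ∫ h, fderiv ℝ (mollifier n) h (L h) = - ∑ i, L (EuclideanSpace.single i 1) i := by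
  have hi : ∀ i, ∫ h, L h i * partialDeriv i (mollifier n) h
      = - L (EuclideanSpace.single i 1) i := fun i => by
    let l : E3 →L[ℝ] ℝ := (EuclideanSpace.proj (𝕜 := ℝ) i : E3 →L[ℝ] ℝ).comp L
    have hl : ∀ h, partialDeriv i (fun h => L h i) h = L (EuclideanSpace.single i 1) i := fun h =>
      show fderiv ℝ l h _ = _ by rw [l.fderiv]; rfl
    rw [integral_mul_partialDeriv (f := fun h => L h i) l.contDiff
      ((isTest_mollifier n).1.of_le (by simp)) (isTest_mollifier n).2]
    simp only [hl]
    rw [integral_const_mul, integral_mollifier, mul_one]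
  simp only [fderiv_eq_sum_partialDeriv, smul_eq_mul]
  rw [integral_finsetSum]
  · simp [hi]
  · intro i _
    have hc : Continuous fun h : E3 => L h i :=
      (EuclideanSpace.proj (𝕜 := ℝ) i : E3 →L[ℝ] ℝ).continuous.comp L.continuous
    exact (hc.mul ((isTest_mollifier n).partialDeriv i).continuous).integrable_of_hasCompactSupport
      ((isTest_mollifier n).partialDeriv i).2.mul_left

lemma ae_tendsto_mollify {a : E3 → ℝ} (ha : LocallyIntegrable a volume) :
    ∀ᵐ x, Tendsto (fun n => mollify (mollifier n) a x) atTop (𝓝 (a x)) := by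
  have h0 : Tendsto (fun n : ℕ => (bump n).rOut) atTop (𝓝 0) := by
    have := (tendsto_one_div_add_atTop_nhds_zero_nat (𝕜 := ℝ)).const_mul 2
    simpa [bump, div_eq_mul_inv] using this
  -- The constant `K = 2` is the ratio of the outer radius to the inner one, as Lebesgue
  -- differentiation requires.
  filter_upwards [ContDiffBump.ae_convolution_tendsto_right_of_locallyIntegrable (φ := bump)
    (K := 2) h0 (Eventually.of_forall fun n => by simp [bump, div_eq_mul_inv]) ha] with x hx
  convert hx using 2 with n
  rw [convolution_eq_swap]
  simp [mollify, mollifier, mul_comm]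

end Mollifier

/-! ### The commutator and its uniform `L¹` bound -/

section Commutator

/-- The DiPerna-Lions commutator `w · ∇(ρ ⋆ a) - ∇ · (ρ ⋆ (a w))` for a divergence free `w`. -/
noncomputable def commutator (ρ a : E3 → ℝ) (w : E3 → E3) (x : E3) : ℝ :=
  ∫ y, a y * fderiv ℝ ρ (x - y) (w x - w y)

variable {a : E3 → ℝ} {u : E3 → E3} {G : Fin 3 → E3 → E3}

lemma commutator_eq_integral_sub (ρ a : E3 → ℝ) (w : E3 → E3) (x : E3) :
    commutator ρ a w x = ∫ h, a (x - h) * fderiv ℝ ρ h (w x - w (x - h)) := by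
  rw [commutator, ← integral_sub_left_eq_self _ volume x]
  simp

lemma stronglyMeasurable_fderiv_apply {α : Type*} [MeasurableSpace α] {ρ : E3 → ℝ}
    (hρ : IsTest ρ) {f w : α → E3} (hf : StronglyMeasurable f) (hw : StronglyMeasurable w) :
    StronglyMeasurable fun z => fderiv ℝ ρ (f z) (w z) :=
  isBoundedBilinearMap_apply.continuous.comp_stronglyMeasurable
    (((hρ.1.continuous_fderiv (by simp)).comp_stronglyMeasurable hf).prodMk hw)

lemma stronglyMeasurable_commutator {ρ : E3 → ℝ} (hρ : IsTest ρ) (ha : StronglyMeasurable a)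
    (hu : StronglyMeasurable u) : StronglyMeasurable (commutator ρ a u) := by
  refine StronglyMeasurable.integral_prod_right' (f := fun p : E3 × E3 =>
    a p.2 * fderiv ℝ ρ (p.1 - p.2) (u p.1 - u p.2)) ?_
  exact (ha.comp_measurable measurable_snd).mul (stronglyMeasurable_fderiv_apply hρ
    (measurable_fst.stronglyMeasurable.sub measurable_snd.stronglyMeasurable)
    ((hu.comp_measurable measurable_fst).sub (hu.comp_measurable measurable_snd)))

/-- After substituting `h = x - y`, Cauchy–Schwarz in `x` and the translation inequality produce a
factor `|h|` for each `h`; integrated against `|∇ρₙ(h)|` it gives the moment, which is independent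
of `n`. -/
lemma lintegral_commutator_le (n : ℕ) (ha : StronglyMeasurable a)
    (hum : StronglyMeasurable u) (hu : HasGradientInL2 u G) :
    ∫⁻ x, ‖commutator (mollifier n) a u x‖ₑ
      ≤ ENNReal.ofReal mollifierMoment * (eLpNorm a 2 volume * gradNorm G) := by
  have hD : Continuous (fderiv ℝ (mollifier n)) :=
    (isTest_mollifier n).1.continuous_fderiv (by simp)
  have hsub : StronglyMeasurable fun p : E3 × E3 => p.1 - p.2 :=
    measurable_fst.stronglyMeasurable.sub measurable_snd.stronglyMeasurable
  have ham : StronglyMeasurable fun p : E3 × E3 => a (p.1 - p.2) :=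
    ha.comp_measurable hsub.measurable
  have hwm : StronglyMeasurable fun p : E3 × E3 => u p.1 - u (p.1 - p.2) :=
    (hum.comp_measurable measurable_fst).sub (hum.comp_measurable hsub.measurable)
  calc ∫⁻ x, ‖commutator (mollifier n) a u x‖ₑ
      ≤ ∫⁻ x, ∫⁻ h, ‖fderiv ℝ (mollifier n) h‖ₑ * (‖a (x - h)‖ₑ * ‖u x - u (x - h)‖ₑ) := by
        refine lintegral_mono fun x => ?_
        rw [commutator_eq_integral_sub]
        refine (enorm_integral_le_lintegral_enorm _).trans (lintegral_mono fun h => ?_)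
        rw [enorm_mul, mul_left_comm]
        gcongr
        exact (fderiv ℝ (mollifier n) h).le_opENorm _
    _ = ∫⁻ h, ∫⁻ x, ‖fderiv ℝ (mollifier n) h‖ₑ * (‖a (x - h)‖ₑ * ‖u x - u (x - h)‖ₑ) := by
        refine lintegral_lintegral_swap (Measurable.aemeasurable ?_)
        exact (hD.enorm.measurable.comp measurable_snd).mul
          (ham.enorm.mul hwm.enorm)
    _ ≤ ∫⁻ h, (‖fderiv ℝ (mollifier n) h‖ₑ * ‖h‖ₑ) * (eLpNorm a 2 volume * gradNorm G) := by
        refine lintegral_mono fun h => ?_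
        have h1 : StronglyMeasurable fun x => a (x - h) :=
          ha.comp_measurable (measurable_id.sub_const h)
        have h2 : StronglyMeasurable fun x => u x - u (x - h) :=
          hum.sub (hum.comp_measurable (measurable_id.sub_const h))
        have h12 : Measurable fun x => ‖a (x - h)‖ₑ * ‖u x - u (x - h)‖ₑ :=
          h1.enorm.mul h2.enorm
        rw [lintegral_const_mul _ h12, mul_assoc]
        gcongr
        refine (lintegral_enorm_mul_enorm_le h1.aestronglyMeasurable
          h2.aestronglyMeasurable).trans ?_
        have h3 : eLpNorm (fun x => a (x - h)) 2 volume = eLpNorm a 2 volume :=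
          eLpNorm_comp_measurePreserving (f := fun x => x - h) ha.aestronglyMeasurable
            (measurePreserving_sub_right volume h)
        rw [h3, mul_left_comm]
        gcongr
        exact hu.eLpNorm_sub_translate_le h
    _ = _ := by
        rw [lintegral_mul_const _ (by fun_prop), lintegral_enorm_mul_fderiv_mollifier]

lemma memLp_norm_fderiv_sub {ρ : E3 → ℝ} (hρ : IsTest ρ) (x : E3) (p : ℝ≥0∞) :
    MemLp (fun y => ‖fderiv ℝ ρ (x - y)‖) p volume :=
  (Continuous.memLp_of_hasCompactSupport
    ((hρ.1.continuous_fderiv (by simp)).comp (by fun_prop : Continuous fun y => x - y))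
    ((hρ.2.fderiv ℝ).comp_homeomorph (Homeomorph.subLeft x))).norm

/-- Local integrability of `u` would not suffice for a product with an `L²` function; the weighted
Sobolev inequality with weight `|∇ρ(x - ·)| ∈ L³` does. -/
lemma HasGradientInL2.memLp_fderiv_apply {ρ : E3 → ℝ} (hρ : IsTest ρ)
    (hu : HasGradientInL2 u G) (x : E3) :
    MemLp (fun y => fderiv ℝ ρ (x - y) (u y)) 2 volume := by
  refine (hu.memLp_smul (memLp_norm_fderiv_sub hρ x 3)).mono ?_ (ae_of_all _ fun y => ?_)
  · exact isBoundedBilinearMap_apply.continuous.comp_aestronglyMeasurable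
      (((hρ.1.continuous_fderiv (by simp)).comp (by fun_prop : Continuous fun y => x - y)
        ).aestronglyMeasurable.prodMk hu.locallyIntegrable.aestronglyMeasurable)
  · rw [norm_smul, norm_norm]
    exact (fderiv ℝ ρ (x - y)).le_opNorm _

lemma memLp_fderiv_sub_apply {ρ : E3 → ℝ} (hρ : IsTest ρ) (x w : E3) :
    MemLp (fun y => fderiv ℝ ρ (x - y) w) 2 volume := by
  have hc : Continuous fun y => fderiv ℝ ρ (x - y) :=
    (hρ.1.continuous_fderiv (by simp)).comp (by fun_prop)
  refine (hc.clm_apply continuous_const).memLp_of_hasCompactSupport ?_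
  exact ((hρ.2.fderiv ℝ).comp_homeomorph (Homeomorph.subLeft x)).comp_left
    (g := fun L : E3 →L[ℝ] ℝ => L w) (by simp)

lemma HasGradientInL2.integrable_commutator {ρ : E3 → ℝ} (hρ : IsTest ρ)
    (hu : HasGradientInL2 u G) (ha : MemLp a 2 volume) (x : E3) :
    Integrable (fun y => a y * fderiv ℝ ρ (x - y) (u x - u y)) volume := by
  have := (memLp_fderiv_sub_apply hρ x (u x)).sub (hu.memLp_fderiv_apply hρ x)
  refine (ha.integrable_mul this).congr (ae_of_all _ fun y => ?_)
  simp

/-- Bilinearity in the pair (scalar, field), prepared for density: the first two terms are small by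
the uniform bound, and the last one has regular data. -/
lemma commutator_split {ρ : E3 → ℝ} (hρ : IsTest ρ)
    (hu : HasGradientInL2 u G) (ha : MemLp a 2 volume) {α : E3 → ℝ} (hα : MemLp α 2 volume)
    {φ : E3 → E3} (hφ : IsTest φ) (x : E3) :
    commutator ρ a u x = commutator ρ (a - α) u x + commutator ρ α (u - φ) x
      + commutator ρ α φ x := by
  have h1 := hu.integrable_commutator hρ (ha.sub hα) x
  have h2 := (hu.sub_test hφ).integrable_commutator hρ hα x
  have h3 : Integrable (fun y => α y * fderiv ℝ ρ (x - y) (φ x - φ y)) volume := by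
    refine ((hu.integrable_commutator hρ hα x).sub h2).congr (ae_of_all _ fun y => ?_)
    simp only [Pi.sub_apply, map_sub]
    ring
  unfold commutator
  rw [← integral_add h1 h2, ← integral_add _ h3]
  swap
  · exact h1.add h2
  refine integral_congr_ae (ae_of_all _ fun y => ?_)
  simp only [Pi.sub_apply, map_sub]
  ring

end Commutator

/-! ### Convergence of the commutator to zero -/

section CommutatorLimit

variable {a : E3 → ℝ} {u : E3 → E3} {G : Fin 3 → E3 → E3}

lemma isLittleO_mul_increment {α : E3 → ℝ} (hα : Continuous α) {φ : E3 → E3}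
    (hφ : Differentiable ℝ φ) (x : E3) :
    (fun h => α (x - h) • (φ x - φ (x - h)) - α x • fderiv ℝ φ x h) =o[𝓝 0] fun h => h := by
  have h1 : (fun h => φ x - φ (x - h) - fderiv ℝ φ x h) =o[𝓝 0] fun h : E3 => h := by
    have hd : HasFDerivAt (fun h => - φ (x - h)) (fderiv ℝ φ x) 0 := by
      have := ((hφ (x - 0)).hasFDerivAt.comp (0 : E3) ((hasFDerivAt_id (0 : E3)).const_sub x)).neg
      simpa [Function.comp_def, Pi.neg_def] using this
    have := hd.isLittleO
    simpa [sub_eq_add_neg, add_comm] using this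
  have hα0 : Tendsto (fun h => α (x - h)) (𝓝 0) (𝓝 (α x)) := by
    have : Continuous fun h => α (x - h) := by fun_prop
    simpa using this.tendsto 0
  have h2 : (fun h => α (x - h) • (φ x - φ (x - h) - fderiv ℝ φ x h)) =o[𝓝 0] fun h : E3 => h := by
    have := (hα0.isBigO_one ℝ).smul_isLittleO h1
    simpa using this
  have h3 : (fun h => (α (x - h) - α x) • fderiv ℝ φ x h) =o[𝓝 0] fun h : E3 => h := by
    have h4 : (fun h => α (x - h) - α x) =o[𝓝 0] fun _ : E3 => (1 : ℝ) := by
      rw [Asymptotics.isLittleO_one_iff]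
      simpa using hα0.sub_const (α x)
    have := h4.smul_isBigO ((fderiv ℝ φ x).isBigO_id (𝓝 0))
    simpa using this
  refine (h2.add h3).congr_left fun h => ?_
  simp only [smul_sub, sub_smul]
  abel

/-- The first order part `α(x) Dφ(x) h` of the integrand contributes exactly the limit, for every
`n`. The remainder is `o(|h|)` on the shrinking support of `∇ρₙ`, hence controlled by the moment. -/
lemma tendsto_commutator_of_continuous {α : E3 → ℝ} (hα : Continuous α) {φ : E3 → E3}
    (hφ : IsTest φ) (x : E3) :
    Tendsto (fun n => commutator (mollifier n) α φ x) atTop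
      (𝓝 (- (α x * ∑ i, partialDeriv i φ x i))) := by
  have hM : 0 ≤ mollifierMoment := integral_nonneg fun h => by positivity
  have hd := hφ.1.differentiable (by simp)
  rw [Metric.tendsto_atTop]
  intro ε hε
  -- The constant is chosen so that its product with the moment is strictly below `ε`; the `+ 1`
  -- keeps the denominator positive.
  obtain ⟨δ, hδ, hb⟩ := Metric.eventually_nhds_iff.1
    ((isLittleO_mul_increment hα hd x).def (c := ε / (2 * (mollifierMoment + 1))) (by positivity))
  obtain ⟨N, hN⟩ := exists_nat_gt (2 / δ)
  refine ⟨N, fun n hn => ?_⟩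
  have hn' : 2 / ((n : ℝ) + 1) < δ := by
    have : (N : ℝ) ≤ n := by exact_mod_cast hn
    rw [div_lt_comm₀ (by positivity) hδ]
    linarith
  have hDc : Continuous (fderiv ℝ (mollifier n)) :=
    (isTest_mollifier n).1.continuous_fderiv (by simp)
  have hDs := (isTest_mollifier n).2.fderiv ℝ
  have hinc : Continuous fun h => φ x - φ (x - h) :=
    continuous_const.sub (hφ.continuous.comp (by fun_prop))
  have i1 : Integrable (fun h => α (x - h) * fderiv ℝ (mollifier n) h (φ x - φ (x - h)))
      volume := by
    refine Continuous.integrable_of_hasCompactSupport ((hα.comp (by fun_prop)).mul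
      (hDc.clm_apply hinc)) (HasCompactSupport.intro hDs fun h hh => ?_)
    simp [image_eq_zero_of_notMem_tsupport hh]
  have i2 : Integrable (fun h => α x * fderiv ℝ (mollifier n) h (fderiv ℝ φ x h))
      volume := by
    refine Continuous.integrable_of_hasCompactSupport (continuous_const.mul
      (hDc.clm_apply (fderiv ℝ φ x).continuous)) (HasCompactSupport.intro hDs fun h hh => ?_)
    simp [image_eq_zero_of_notMem_tsupport hh]
  have heq : - (α x * ∑ i, partialDeriv i φ x i)
      = ∫ h, α x * fderiv ℝ (mollifier n) h (fderiv ℝ φ x h) := by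
    rw [integral_const_mul, integral_fderiv_mollifier_apply]
    simp [partialDeriv]
  rw [commutator_eq_integral_sub, heq, dist_eq_norm, ← integral_sub i1 i2]
  calc _ ≤ ∫ h, ε / (2 * (mollifierMoment + 1)) * (‖h‖ * ‖fderiv ℝ (mollifier n) h‖) := by
        refine norm_integral_le_of_norm_le
          ((integrable_norm_mul_fderiv (isTest_mollifier n)).const_mul _)
          (ae_of_all _ fun h => ?_)
        rcases le_or_gt ‖h‖ (2 / ((n : ℝ) + 1)) with hh | hh
        · have := hb (y := h) (by simpa using hh.trans_lt hn')
          calc _ = ‖fderiv ℝ (mollifier n) h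
                (α (x - h) • (φ x - φ (x - h)) - α x • fderiv ℝ φ x h)‖ := by
                simp only [map_sub, map_smul, smul_eq_mul]
            _ ≤ ‖fderiv ℝ (mollifier n) h‖ * (ε / (2 * (mollifierMoment + 1)) * ‖h‖) :=
                ((fderiv ℝ (mollifier n) h).le_opNorm _).trans (by gcongr)
            _ = _ := by ring
        · simp [fderiv_mollifier_eq_zero hh]
    _ = ε / (2 * (mollifierMoment + 1)) * mollifierMoment := by
        rw [integral_const_mul, integral_norm_mul_fderiv_mollifier]
    _ < ε := by
        rw [div_mul_eq_mul_div, div_lt_iff₀ (by positivity)]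
        nlinarith

lemma norm_commutator_le_of_bounded {α : E3 → ℝ} {φ : E3 → E3} {M L : ℝ}
    (hM : ∀ y, ‖α y‖ ≤ M) (hL : ∀ x y, ‖φ x - φ y‖ ≤ L * ‖x - y‖) (n : ℕ) (x : E3) :
    ‖commutator (mollifier n) α φ x‖ ≤ M * L * mollifierMoment := by
  have hM0 : 0 ≤ M := (norm_nonneg _).trans (hM 0)
  rw [commutator_eq_integral_sub, ← integral_norm_mul_fderiv_mollifier n, ← integral_const_mul]
  refine norm_integral_le_of_norm_le
    ((integrable_norm_mul_fderiv (isTest_mollifier n)).const_mul _) (ae_of_all _ fun h => ?_)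
  rw [norm_mul]
  calc _ ≤ M * (‖fderiv ℝ (mollifier n) h‖ * (L * ‖h‖)) := by
        gcongr
        · exact hM _
        · refine ((fderiv ℝ (mollifier n) h).le_opNorm _).trans ?_
          gcongr
          simpa using hL x (x - h)
    _ = _ := by ring

/-- The margin `2` is the largest outer radius of the mollifiers, attained at `n = 0`. -/
lemma commutator_eq_zero_of_notMem {α : E3 → ℝ} {φ : E3 → E3} {R : ℝ}
    (hR : ∀ y, R < ‖y‖ → α y = 0) (n : ℕ) {x : E3} (hx : R + 2 < ‖x‖) :
    commutator (mollifier n) α φ x = 0 := by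
  rw [commutator_eq_integral_sub]
  refine integral_eq_zero_of_ae (ae_of_all _ fun h => ?_)
  rcases le_or_gt ‖h‖ (2 / ((n : ℝ) + 1)) with hh | hh
  · have h2 : 2 / ((n : ℝ) + 1) ≤ 2 := div_le_self (by norm_num) (by simp)
    have := norm_sub_norm_le x h
    simp [hR (x - h) (by linarith)]
  · simp [fderiv_mollifier_eq_zero hh]

/-- Dominated convergence, the majorant being a constant on a fixed ball. The limit need not vanish,
since an approximation `φ` of `u` need not be divergence free. -/
lemma tendsto_lintegral_commutator_of_continuous {α : E3 → ℝ} (hα : Continuous α)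
    (hαs : HasCompactSupport α) {φ : E3 → E3} (hφ : IsTest φ) :
    Tendsto (fun n => ∫⁻ x, ‖commutator (mollifier n) α φ x‖ₑ) atTop
      (𝓝 (∫⁻ x, ‖- (α x * ∑ i, partialDeriv i φ x i)‖ₑ)) := by
  obtain ⟨M, hM⟩ := hα.bounded_above_of_compact_support hαs
  obtain ⟨L, hL⟩ := (hφ.1.of_le (by simp)).lipschitzWith_of_hasCompactSupport hφ.2
    (n := 1) (𝕂 := ℝ) (by norm_num)
  obtain ⟨R, hR⟩ := hαs.isCompact.isBounded.subset_closedBall (0 : E3)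
  have hR' : ∀ y, R < ‖y‖ → α y = 0 := fun y hy => by
    apply image_eq_zero_of_notMem_tsupport
    intro hc
    have := hR hc
    simp at this
    linarith
  refine tendsto_lintegral_of_dominated_convergence
    ((Metric.closedBall (0 : E3) (R + 2)).indicator
      fun _ => ENNReal.ofReal (M * L * mollifierMoment)) (fun n => ?_) (fun n => ?_) ?_ ?_
  · exact (stronglyMeasurable_commutator (isTest_mollifier n) hα.stronglyMeasurable
      hφ.continuous.stronglyMeasurable).enorm
  · refine ae_of_all _ fun x => ?_
    by_cases hx : x ∈ Metric.closedBall (0 : E3) (R + 2)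
    · simp only [hx, indicator_of_mem]
      rw [← ofReal_norm]
      exact ENNReal.ofReal_le_ofReal (norm_commutator_le_of_bounded hM
        (fun x y => by simpa [dist_eq_norm] using hL.dist_le_mul x y) n x)
    · simp only [hx, not_false_eq_true, indicator_of_notMem]
      rw [commutator_eq_zero_of_notMem hR' n (by simpa using hx)]
      simp
  · rw [lintegral_indicator_const Metric.isClosed_closedBall.measurableSet]
    exact ENNReal.mul_ne_top (by simp) measure_closedBall_lt_top.ne
  · exact ae_of_all _ fun x => (tendsto_commutator_of_continuous hα hφ x).enorm

/-- The commutator converges to zero in `L¹`. -/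
lemma tendsto_lintegral_commutator (ham : StronglyMeasurable a) (ha : MemLp a 2 volume)
    (hum : StronglyMeasurable u) (hu : HasGradientInL2 u G) (htr : ∀ᵐ x, ∑ i, G i x i = 0) :
    Tendsto (fun n => ∫⁻ x, ‖commutator (mollifier n) a u x‖ₑ) atTop (𝓝 0) := by
  set C := ENNReal.ofReal mollifierMoment
  -- This bounds the norm of every approximation of `a` within `δ ≤ 1`; `K` below collects the
  -- coefficients of `δ` in the final estimate.
  set A := eLpNorm a 2 volume + 1
  have hA : A ≠ ⊤ := by simpa [A] using ha.2.ne
  set K := C * gradNorm G + C * A + A + 1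
  have hK : K ≠ ⊤ := by
    simp only [K, ne_eq, ENNReal.add_eq_top, not_or]
    exact ⟨⟨⟨ENNReal.mul_ne_top (by simp [C]) hu.gradNorm_ne_top,
      ENNReal.mul_ne_top (by simp [C]) hA⟩, hA⟩, by simp⟩
  have key : ∀ δ : ℝ≥0∞, δ ≠ 0 → δ ≤ 1 →
      ∀ᶠ n in atTop, ∫⁻ x, ‖commutator (mollifier n) a u x‖ₑ ≤ K * δ := by
    intro δ hδ hδ1
    obtain ⟨α, hαs, hαa, hα, hαL⟩ := ha.exists_hasCompactSupport_eLpNorm_sub_le (by simp) hδ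
    obtain ⟨φ, hφ, hφG⟩ := hu.exists_gradNorm_sub_le hδ
    have hαA : eLpNorm α 2 volume ≤ A := by
      have := eLpNorm_add_le (μ := volume) (p := 2) (hαL.sub ha).1 ha.1 (by norm_num)
      rw [sub_add_cancel, eLpNorm_sub_comm] at this
      refine this.trans ?_
      rw [add_comm]
      exact add_le_add le_rfl (hαa.trans hδ1)
    -- Since `G` is trace free, `∇ · φ` is minus the trace of `G - ∇φ`, which is small in `L²`.
    have hdiv : ∫⁻ x, ‖- (α x * ∑ i, partialDeriv i φ x i)‖ₑ ≤ A * δ := by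
      have hG : ∀ i, AEStronglyMeasurable (fun x => (G i - partialDeriv i φ) x i) volume :=
        fun i => (EuclideanSpace.proj (𝕜 := ℝ) i : E3 →L[ℝ] ℝ).continuous.comp_aestronglyMeasurable
          ((hu.memLp_gradient i).1.sub ((hφ.partialDeriv i).memLp 2).1)
      calc _ = ∫⁻ x, ‖α x‖ₑ * ‖(∑ i, fun x => (G i - partialDeriv i φ) x i) x‖ₑ := by
            refine lintegral_congr_ae ?_
            filter_upwards [htr] with x hx
            rw [enorm_neg, enorm_mul]
            simp [Finset.sum_sub_distrib, hx]
        _ ≤ eLpNorm α 2 volume * eLpNorm (∑ i, fun x => (G i - partialDeriv i φ) x i) 2 volume :=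
            lintegral_enorm_mul_enorm_le hα.aestronglyMeasurable
              (Finset.aestronglyMeasurable_sum _ fun i _ => hG i)
        _ ≤ A * gradNorm (fun i => G i - partialDeriv i φ) := by
            gcongr
            refine (eLpNorm_sum_le (fun i _ => hG i) (by norm_num)).trans ?_
            unfold gradNorm
            gcongr with i
            exact eLpNorm_mono fun x => norm_coord_le ((G i - partialDeriv i φ) x) i
        _ ≤ _ := by gcongr
    have hev : ∀ᶠ n in atTop,
        ∫⁻ x, ‖commutator (mollifier n) α φ x‖ₑ ≤ A * δ + δ := by
      have hlt : ∫⁻ x, ‖- (α x * ∑ i, partialDeriv i φ x i)‖ₑ < A * δ + δ :=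
        hdiv.trans_lt (ENNReal.lt_add_right
          (ENNReal.mul_ne_top hA (hδ1.trans_lt ENNReal.one_lt_top).ne) hδ)
      exact ((tendsto_lintegral_commutator_of_continuous hα hαs hφ).eventually_lt_const hlt).mono
        fun n hn => hn.le
    filter_upwards [hev] with n hn
    have hρ := isTest_mollifier n
    have m1 := stronglyMeasurable_commutator hρ (ham.sub hα.stronglyMeasurable) hum
    have m2 := stronglyMeasurable_commutator hρ hα.stronglyMeasurable
      (hum.sub hφ.continuous.stronglyMeasurable)
    calc ∫⁻ x, ‖commutator (mollifier n) a u x‖ₑ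
        ≤ ∫⁻ x, (‖commutator (mollifier n) (a - α) u x‖ₑ
            + ‖commutator (mollifier n) α (u - φ) x‖ₑ + ‖commutator (mollifier n) α φ x‖ₑ) := by
          refine lintegral_mono fun x => ?_
          rw [commutator_split hρ hu ha hαL hφ x]
          exact (enorm_add_le _ _).trans (add_le_add (enorm_add_le _ _) le_rfl)
      _ = (∫⁻ x, ‖commutator (mollifier n) (a - α) u x‖ₑ)
            + (∫⁻ x, ‖commutator (mollifier n) α (u - φ) x‖ₑ)
            + ∫⁻ x, ‖commutator (mollifier n) α φ x‖ₑ := by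
          have m12 : Measurable fun x => ‖commutator (mollifier n) (a - α) u x‖ₑ
              + ‖commutator (mollifier n) α (u - φ) x‖ₑ := m1.enorm.add m2.enorm
          rw [← lintegral_add_left m1.enorm, ← lintegral_add_left m12]
      _ ≤ C * (δ * gradNorm G) + C * (A * δ) + (A * δ + δ) := by
          refine add_le_add (add_le_add ?_ ?_) hn
          · refine (lintegral_commutator_le n (ham.sub hα.stronglyMeasurable) hum hu).trans ?_
            gcongr
          · refine (lintegral_commutator_le n hα.stronglyMeasurable
              (hum.sub hφ.continuous.stronglyMeasurable) (hu.sub_test hφ)).trans ?_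
            gcongr
      _ = K * δ := by simp only [K]; ring
  rw [ENNReal.tendsto_nhds_zero]
  intro ε hε
  have hK0 : K ≠ 0 := by simp [K]
  filter_upwards [key (min 1 (ε / K)) (by
    simp only [ne_eq, min_eq_iff, not_or, ENNReal.div_eq_zero_iff]
    simp [hε.ne', hK]) (min_le_left _ _)] with n hn
  refine hn.trans ((mul_le_mul' le_rfl (min_le_right _ _)).trans ?_)
  exact ENNReal.mul_div_le

end CommutatorLimit

/-! ### The renormalizing function -/

section Renormalization

/-- A smooth convex function, quadratic at the origin and with bounded slope. -/
noncomputable def renorm (s : ℝ) : ℝ := √(1 + s ^ 2) - 1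

lemma contDiff_renorm : ContDiff ℝ ∞ renorm :=
  ContDiff.sub (ContDiff.sqrt (by fun_prop) fun s => by positivity) contDiff_const

lemma hasDerivAt_renorm (s : ℝ) : HasDerivAt renorm (s / √(1 + s ^ 2)) s := by
  have h2 : HasDerivAt (fun s : ℝ => 1 + s ^ 2) (2 * s) s := by
    simpa using (hasDerivAt_pow 2 s).const_add 1
  have h := (h2.sqrt (by positivity)).sub_const 1
  rw [mul_div_mul_left _ _ two_ne_zero] at h
  exact h

lemma deriv_renorm : deriv renorm = fun s => s / √(1 + s ^ 2) :=
  funext fun s => (hasDerivAt_renorm s).deriv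

/-- Boundedness of the slope is what lets an `L¹` commutator be absorbed. -/
lemma abs_deriv_renorm_le (s : ℝ) : |deriv renorm s| ≤ 1 := by
  rw [deriv_renorm, abs_div, abs_of_nonneg (Real.sqrt_nonneg _), div_le_one (by positivity)]
  exact Real.abs_le_sqrt (by linarith)

/-- Convexity gives the dissipation `β''(g) |∇g|²` its sign. -/
lemma deriv_deriv_renorm_nonneg (s : ℝ) : 0 ≤ deriv (deriv renorm) s := by
  have hs : HasDerivAt (fun s : ℝ => √(1 + s ^ 2)) (s / √(1 + s ^ 2)) s := by
    simpa [renorm] using (hasDerivAt_renorm s).add_const 1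
  have h := (hasDerivAt_id s).div hs (by positivity)
  rw [deriv_renorm]
  refine le_of_le_of_eq ?_ h.deriv.symm
  have hp : 0 < √(1 + s ^ 2) := by positivity
  have hq : √(1 + s ^ 2) ^ 2 = 1 + s ^ 2 := Real.sq_sqrt (by positivity)
  refine div_nonneg ?_ (sq_nonneg _)
  simp only [id, one_mul]
  rw [← mul_div_assoc, sub_nonneg, div_le_iff₀ hp]
  nlinarith

lemma renorm_zero : renorm 0 = 0 := by simp [renorm]

lemma renorm_nonneg (s : ℝ) : 0 ≤ renorm s := by
  have : (1 : ℝ) ≤ √(1 + s ^ 2) := Real.one_le_sqrt.2 (by nlinarith)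
  simp only [renorm]; linarith

/-- Linear growth serves the flux term, where one factor `L²` is left for `|∇χ| u`; the quadratic
bound that follows serves the term in `Δχ`, where only `aₙ² ∈ L¹` is available. -/
lemma renorm_le_abs (s : ℝ) : renorm s ≤ |s| := by
  have : √(1 + s ^ 2) ≤ 1 + |s| :=
    Real.sqrt_le_iff.2 ⟨by positivity, by nlinarith [sq_abs s, abs_nonneg s]⟩
  simp only [renorm]; linarith

lemma renorm_le_sq (s : ℝ) : renorm s ≤ s ^ 2 := by
  have : √(1 + s ^ 2) ≤ 1 + s ^ 2 :=
    Real.sqrt_le_iff.2 ⟨by positivity, by nlinarith [sq_nonneg s]⟩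
  simp only [renorm]; linarith

lemma eq_zero_of_renorm_eq_zero {s : ℝ} (h : renorm s = 0) : s = 0 := by
  have h1 : √(1 + s ^ 2) = 1 := by simp only [renorm] at h; linarith
  rw [Real.sqrt_eq_one] at h1
  simpa using h1

end Renormalization

/-! ### The renormalized inequality at a fixed time -/

section SliceInequality

variable {a : E3 → ℝ} {u : E3 → E3} {G : Fin 3 → E3 → E3}

/-- The right-hand side of the evolution equation of `ρ ⋆ a`. -/
noncomputable def source (ρ a : E3 → ℝ) (w : E3 → E3) (x : E3) : ℝ :=
  ∫ y, a y * (inner ℝ (w y) (gradient (fun y => ρ (x - y)) y)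
    + Laplacian.laplacian (fun y => ρ (x - y)) y)

lemma inner_gradient_eq_fderiv (w : E3) (φ : E3 → ℝ) (x : E3) :
    inner ℝ w (gradient φ x) = fderiv ℝ φ x w := by
  rw [inner_gradient_eq_sum, fderiv_eq_sum_partialDeriv]; simp

lemma inner_gradient_const_sub {ρ : E3 → ℝ} (hρ : IsTest ρ) (x y w : E3) :
    inner ℝ w (gradient (fun y => ρ (x - y)) y) = - fderiv ℝ ρ (x - y) w := by
  rw [inner_gradient_eq_sum, fderiv_eq_sum_partialDeriv, ← Finset.sum_neg_distrib]
  simp [partialDeriv_const_sub_comp (hρ.1.differentiable (by simp))]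

lemma laplacian_const_sub {ρ : E3 → ℝ} (hρ : IsTest ρ) (x y : E3) :
    Laplacian.laplacian (fun y => ρ (x - y)) y = ∑ i, partialDeriv i (partialDeriv i ρ) (x - y) := by
  rw [laplacian_eq_sum_partialDeriv (by exact_mod_cast contDiff_infty.1 (hρ.comp_const_sub x).1 2)]
  refine Finset.sum_congr rfl fun i _ => ?_
  have h1 : partialDeriv i (fun y => ρ (x - y)) = fun y => - partialDeriv i ρ (x - y) :=
    funext fun y => partialDeriv_const_sub_comp (hρ.1.differentiable (by simp)) x i y
  have h2 : partialDeriv i (fun y => - partialDeriv i ρ (x - y)) y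
      = - partialDeriv i (fun y => partialDeriv i ρ (x - y)) y := by
    unfold partialDeriv
    rw [fderiv_fun_neg]; rfl
  rw [h1, h2, partialDeriv_const_sub_comp ((hρ.partialDeriv i).1.differentiable (by simp)), neg_neg]

lemma integrable_mul_test_sub {k : E3 → ℝ} (hk : IsTest k) (ha : MemLp a 2 volume) (x : E3) :
    Integrable (fun y => a y * k (x - y)) volume :=
  ha.integrable_mul ((hk.comp_const_sub x).memLp 2)

lemma fderiv_mollify_apply {ρ : E3 → ℝ} (hρ : IsTest ρ) (ha : MemLp a 2 volume) (x w : E3) :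
    fderiv ℝ (mollify ρ a) x w = ∫ y, a y * fderiv ℝ ρ (x - y) w := by
  simp only [fderiv_eq_sum_partialDeriv, Finset.mul_sum, smul_eq_mul]
  rw [integral_finsetSum]
  · refine Finset.sum_congr rfl fun i _ => ?_
    rw [partialDeriv_mollify hρ (ha.locallyIntegrable (by norm_num)), mollify, ← integral_const_mul]
    exact integral_congr_ae (ae_of_all _ fun y => by ring)
  · intro i _
    refine ((integrable_mul_test_sub (hρ.partialDeriv i) ha x).const_mul (w i)).congr
      (ae_of_all _ fun y => by ring)

/-- The mollified equation: under the integral, `u(y)` is replaced by `u(x)`, and the commutator is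
the price. -/
lemma source_eq {ρ : E3 → ℝ} (hρ : IsTest ρ) (ha : MemLp a 2 volume)
    (hu : HasGradientInL2 u G) (x : E3) :
    source ρ a u x = ∑ i, partialDeriv i (partialDeriv i (mollify ρ a)) x
      + commutator ρ a u x - fderiv ℝ (mollify ρ a) x (u x) := by
  have hal := ha.locallyIntegrable (by norm_num)
  have i1 : Integrable (fun y => a y * ∑ i, partialDeriv i (partialDeriv i ρ) (x - y)) volume := by
    simp only [Finset.mul_sum]
    exact integrable_finsetSum _ fun i _ =>
      integrable_mul_test_sub ((hρ.partialDeriv i).partialDeriv i) ha x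
  have i2 := hu.integrable_commutator hρ ha x
  have i3 : Integrable (fun y => a y * fderiv ℝ ρ (x - y) (u x)) volume :=
    ha.integrable_mul (memLp_fderiv_sub_apply hρ x (u x))
  have h1 : ∑ i, partialDeriv i (partialDeriv i (mollify ρ a)) x
      = ∫ y, a y * ∑ i, partialDeriv i (partialDeriv i ρ) (x - y) := by
    simp only [Finset.mul_sum]
    rw [integral_finsetSum _ fun i _ =>
      integrable_mul_test_sub ((hρ.partialDeriv i).partialDeriv i) ha x]
    refine Finset.sum_congr rfl fun i _ => ?_
    rw [partialDeriv_mollify hρ hal, partialDeriv_mollify (hρ.partialDeriv i) hal, mollify]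
  rw [h1, fderiv_mollify_apply hρ ha, commutator, ← integral_add i1 i2, ← integral_sub _ i3]
  swap
  · exact i1.add i2
  refine integral_congr_ae (ae_of_all _ fun y => ?_)
  simp only [inner_gradient_const_sub hρ, laplacian_const_sub hρ, map_sub]
  ring

lemma integrable_apply_of_hasCompactSupport {L : E3 → E3 →L[ℝ] ℝ} (hL : Continuous L)
    (hLs : HasCompactSupport L) (hu : LocallyIntegrable u volume) :
    Integrable (fun x => L x (u x)) volume := by
  refine (hu.integrable_smul_left_of_hasCompactSupport hL.norm hLs.norm).mono
    (isBoundedBilinearMap_apply.continuous.comp_aestronglyMeasurable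
      (hL.aestronglyMeasurable.prodMk hu.aestronglyMeasurable)) (ae_of_all _ fun x => ?_)
  rw [norm_smul, norm_norm]
  exact (L x).le_opNorm _

/-- Transport by a divergence free field, in renormalized form. -/
lemma integral_transport {g χ : E3 → ℝ} (hg : ContDiff ℝ ∞ g) (hχ : IsTest χ)
    (hu : LocallyIntegrable u volume)
    (hdiv : ∀ ψ : E3 → ℝ, IsTest ψ → ∫ x, inner ℝ (u x) (gradient ψ x) = 0) :
    Integrable (fun x => χ x * (deriv renorm (g x) * fderiv ℝ g x (u x))) volume ∧
    Integrable (fun x => renorm (g x) * fderiv ℝ χ x (u x)) volume ∧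
    ∫ x, χ x * (deriv renorm (g x) * fderiv ℝ g x (u x))
      = - ∫ x, renorm (g x) * fderiv ℝ χ x (u x) := by
  have hb : ContDiff ℝ ∞ fun x => renorm (g x) := contDiff_renorm.comp hg
  have hb' : Continuous (deriv renorm) := contDiff_renorm.continuous_deriv (by simp)
  have hgc : Continuous (fderiv ℝ g) := hg.continuous_fderiv (by simp)
  have hχc : Continuous (fderiv ℝ χ) := hχ.1.continuous_fderiv (by simp)
  have i1 : Integrable (fun x => χ x * (deriv renorm (g x) * fderiv ℝ g x (u x))) volume := by
    have hc : Continuous fun x => (χ x * deriv renorm (g x)) • fderiv ℝ g x :=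
      (hχ.continuous.mul (hb'.comp hg.continuous)).smul hgc
    have hs : HasCompactSupport fun x => (χ x * deriv renorm (g x)) • fderiv ℝ g x :=
      HasCompactSupport.intro hχ.2 fun x hx => by simp [image_eq_zero_of_notMem_tsupport hx]
    exact (integrable_apply_of_hasCompactSupport hc hs hu).congr
      (ae_of_all _ fun x => by simp [mul_assoc])
  have i2 : Integrable (fun x => renorm (g x) * fderiv ℝ χ x (u x)) volume := by
    have hc : Continuous fun x => renorm (g x) • fderiv ℝ χ x := hb.continuous.smul hχc
    have hs : HasCompactSupport fun x => renorm (g x) • fderiv ℝ χ x :=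
      HasCompactSupport.intro (hχ.2.fderiv ℝ) fun x hx => by
        simp [image_eq_zero_of_notMem_tsupport hx]
    exact (integrable_apply_of_hasCompactSupport hc hs hu).congr (ae_of_all _ fun x => by simp)
  refine ⟨i1, i2, ?_⟩
  -- Because `g` is smooth, `χ β(g)` is itself admissible in the divergence condition, and the two
  -- terms of its gradient are the two integrals compared.
  have hψ : IsTest fun x => χ x * renorm (g x) := ⟨hχ.1.mul hb, hχ.2.mul_right⟩
  have h := hdiv _ hψ
  have heq : ∀ x, inner ℝ (u x) (gradient (fun x => χ x * renorm (g x)) x)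
      = χ x * (deriv renorm (g x) * fderiv ℝ g x (u x)) + renorm (g x) * fderiv ℝ χ x (u x) := by
    intro x
    have h1 := ((contDiff_renorm.differentiable (by simp) (g x)).hasDerivAt.comp_hasFDerivAt x
      (hg.differentiable (by simp) x).hasFDerivAt)
    have h2 := (hχ.1.differentiable (by simp) x).hasFDerivAt.mul h1
    rw [inner_gradient_eq_fderiv, show (fun x => χ x * renorm (g x)) = χ * (renorm ∘ g) from rfl,
      h2.fderiv]
    simp
  simp only [heq] at h
  rw [integral_add i1 i2] at h
  linarith

/-- One has `Δβ(g) = β'(g) Δg + β''(g) |∇g|² ≥ β'(g) Δg`; two integrations by parts then move the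
Laplacian to `χ`. -/
lemma integral_laplacian_le {g χ : E3 → ℝ} (hg : ContDiff ℝ ∞ g) (hχ : IsTest χ)
    (h0 : ∀ x, 0 ≤ χ x) :
    ∫ x, χ x * (deriv renorm (g x) * ∑ i, partialDeriv i (partialDeriv i g) x)
      ≤ ∫ x, renorm (g x) * ∑ i, partialDeriv i (partialDeriv i χ) x := by
  have hb : ContDiff ℝ ∞ fun x => renorm (g x) := contDiff_renorm.comp hg
  have hb1 : ContDiff ℝ ∞ (deriv renorm) := contDiff_renorm.deriv' (n := ∞)
  have hdb : ∀ i, partialDeriv i (fun x => renorm (g x))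
      = fun x => deriv renorm (g x) * partialDeriv i g x := fun i => funext fun x =>
    partialDeriv_comp (contDiff_renorm.differentiable (by simp) _) (hg.differentiable (by simp) x) i
  have hddb : ∀ i x, partialDeriv i (partialDeriv i (fun x => renorm (g x))) x
      = deriv (deriv renorm) (g x) * partialDeriv i g x ^ 2
        + deriv renorm (g x) * partialDeriv i (partialDeriv i g) x := fun i x => by
    rw [hdb, partialDeriv_mul (f := fun x => deriv renorm (g x))
      ((hb1.comp hg).differentiable (by simp) x)
      ((contDiff_partialDeriv hg i).differentiable (by simp) x),
      partialDeriv_comp (hb1.differentiable (by simp) _) (hg.differentiable (by simp) x)]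
    ring
  have hcont : ∀ i, Continuous (partialDeriv i (partialDeriv i fun x => renorm (g x))) := fun i =>
    (contDiff_partialDeriv (contDiff_partialDeriv hb i) i).continuous
  have i1 : ∀ i, Integrable (fun x => χ x * partialDeriv i (partialDeriv i fun x => renorm (g x)) x)
      volume := fun i =>
    (hχ.continuous.mul (hcont i)).integrable_of_hasCompactSupport hχ.2.mul_right
  have hibp : ∀ i, ∫ x, χ x * partialDeriv i (partialDeriv i fun x => renorm (g x)) x
      = ∫ x, renorm (g x) * partialDeriv i (partialDeriv i χ) x := fun i => by
    have e1 := integral_mul_partialDeriv (hb.of_le (by simp)) ((hχ.partialDeriv i).1.of_le (by simp))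
      (hχ.partialDeriv i).2 i
    have e2 := integral_mul_partialDeriv ((contDiff_partialDeriv hb i).of_le (by simp))
      (hχ.1.of_le (by simp)) hχ.2 i
    rw [e1, e2, neg_neg]
    exact integral_congr_ae (ae_of_all _ fun x => mul_comm _ _)
  calc ∫ x, χ x * (deriv renorm (g x) * ∑ i, partialDeriv i (partialDeriv i g) x)
      ≤ ∫ x, ∑ i, χ x * partialDeriv i (partialDeriv i fun x => renorm (g x)) x := by
        refine integral_mono ?_ (integrable_finsetSum _ fun i _ => i1 i) fun x => ?_
        · refine Continuous.integrable_of_hasCompactSupport ?_ hχ.2.mul_right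
          exact hχ.continuous.mul ((hb1.continuous.comp hg.continuous).mul (continuous_finsetSum _
            fun i _ => (contDiff_partialDeriv (contDiff_partialDeriv hg i) i).continuous))
        · simp only [Finset.mul_sum]
          refine Finset.sum_le_sum fun i _ => mul_le_mul_of_nonneg_left ?_ (h0 x)
          rw [hddb]
          have := mul_nonneg (deriv_deriv_renorm_nonneg (g x)) (sq_nonneg (partialDeriv i g x))
          linarith
    _ = ∑ i, ∫ x, renorm (g x) * partialDeriv i (partialDeriv i χ) x := by
        rw [integral_finsetSum _ fun i _ => i1 i]
        exact Finset.sum_congr rfl fun i _ => hibp i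
    _ = _ := by
        simp only [Finset.mul_sum]
        rw [integral_finsetSum]
        exact fun i _ => (hb.continuous.mul
          ((hχ.partialDeriv i).partialDeriv i).continuous).integrable_of_hasCompactSupport
          ((hχ.partialDeriv i).partialDeriv i).2.mul_left

/-- The Laplacian as a sum of second order partial derivatives. -/
noncomputable def lapl (χ : E3 → ℝ) (x : E3) : ℝ := ∑ i, partialDeriv i (partialDeriv i χ) x

lemma continuous_lapl {χ : E3 → ℝ} (hχ : ContDiff ℝ ∞ χ) : Continuous (lapl χ) :=
  continuous_finsetSum _ fun i _ =>
    (contDiff_partialDeriv (contDiff_partialDeriv hχ i) i).continuous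

lemma hasCompactSupport_lapl {χ : E3 → ℝ} (hχ : IsTest χ) : HasCompactSupport (lapl χ) := by
  have : ∀ s : Finset (Fin 3), HasCompactSupport
      (∑ i ∈ s, partialDeriv i (partialDeriv i χ)) := fun s => by
    induction s using Finset.induction_on with
    | empty => simpa using HasCompactSupport.zero
    | insert i s hi ih =>
      rw [Finset.sum_insert hi]
      exact ((hχ.partialDeriv i).partialDeriv i).2.add ih
  convert this Finset.univ
  ext x; simp [lapl]

/-- The renormalized energy inequality at a fixed time. -/
lemma ofReal_integral_source_le {ρ χ : E3 → ℝ} (hρ : IsTest ρ) (hχ : IsTest χ)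
    (h0 : ∀ x, 0 ≤ χ x) (h1 : ∀ x, χ x ≤ 1) (ha : MemLp a 2 volume)
    (ham : StronglyMeasurable a) (hum : StronglyMeasurable u) (hu : HasGradientInL2 u G)
    (hdiv : ∀ ψ : E3 → ℝ, IsTest ψ → ∫ x, inner ℝ (u x) (gradient ψ x) = 0) :
    ENNReal.ofReal (∫ x, χ x * (deriv renorm (mollify ρ a x) * source ρ a u x))
      ≤ (∫⁻ x, ‖mollify ρ a x‖ₑ * ‖‖fderiv ℝ χ x‖ • u x‖ₑ)
        + (∫⁻ x, ‖mollify ρ a x‖ₑ ^ 2 * ‖lapl χ x‖ₑ)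
        + ∫⁻ x, ‖commutator ρ a u x‖ₑ := by
  -- If the commutator is not integrable the right side is infinite; otherwise all the terms may be
  -- integrated separately.
  by_cases hc : ∫⁻ x, ‖commutator ρ a u x‖ₑ = ⊤
  · simp [hc]
  set g := mollify ρ a
  have hg : ContDiff ℝ ∞ g := contDiff_mollify hρ (ha.locallyIntegrable (by norm_num))
  have hb1 : Continuous (deriv renorm) := contDiff_renorm.continuous_deriv (by simp)
  have hci : Integrable (commutator ρ a u) volume :=
    ⟨(stronglyMeasurable_commutator hρ ham hum).aestronglyMeasurable, lt_top_iff_ne_top.2 hc⟩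
  obtain ⟨iT, iT', hT⟩ := integral_transport hg hχ hu.locallyIntegrable hdiv
  have iL : Integrable (fun x => χ x * (deriv renorm (g x) *
      ∑ i, partialDeriv i (partialDeriv i g) x)) volume := by
    refine Continuous.integrable_of_hasCompactSupport ?_ hχ.2.mul_right
    exact hχ.continuous.mul ((hb1.comp hg.continuous).mul (continuous_lapl hg))
  have hcn : ∀ x, ‖χ x * (deriv renorm (g x) * commutator ρ a u x)‖ ≤ ‖commutator ρ a u x‖ := by
    intro x
    rw [norm_mul, norm_mul, Real.norm_of_nonneg (h0 x), Real.norm_eq_abs (deriv renorm _)]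
    calc _ ≤ 1 * (1 * ‖commutator ρ a u x‖) := by
          gcongr
          · exact h1 x
          · exact abs_deriv_renorm_le _
      _ = _ := by ring
  have iC : Integrable (fun x => χ x * (deriv renorm (g x) * commutator ρ a u x)) volume :=
    hci.mono (hχ.continuous.aestronglyMeasurable.mul
      ((hb1.comp hg.continuous).aestronglyMeasurable.mul hci.1)) (ae_of_all _ hcn)
  have hsplit : ∫ x, χ x * (deriv renorm (g x) * source ρ a u x)
      = (∫ x, χ x * (deriv renorm (g x) * ∑ i, partialDeriv i (partialDeriv i g) x))
        + (∫ x, χ x * (deriv renorm (g x) * commutator ρ a u x))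
        - ∫ x, χ x * (deriv renorm (g x) * fderiv ℝ g x (u x)) := by
    rw [← integral_add iL iC, ← integral_sub _ iT]
    swap
    · exact iL.add iC
    refine integral_congr_ae (ae_of_all _ fun x => ?_)
    simp only [source_eq hρ ha hu x]
    ring
  have hle : ∫ x, χ x * (deriv renorm (g x) * source ρ a u x)
      ≤ (∫ x, renorm (g x) * fderiv ℝ χ x (u x)) + (∫ x, renorm (g x) * lapl χ x)
        + ∫ x, χ x * (deriv renorm (g x) * commutator ρ a u x) := by
    rw [hsplit, hT]
    have := integral_laplacian_le hg hχ h0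
    simp only [lapl]
    linarith
  have habs : ∀ {f : E3 → ℝ}, ENNReal.ofReal (∫ x, f x) ≤ ∫⁻ x, ‖f x‖ₑ := fun {f} =>
    (ENNReal.ofReal_le_ofReal (le_abs_self _)).trans
      ((Real.enorm_eq_ofReal_abs _).symm.le.trans (enorm_integral_le_lintegral_enorm _))
  refine (ENNReal.ofReal_le_ofReal hle).trans (ENNReal.ofReal_add_le.trans
    (add_le_add (ENNReal.ofReal_add_le.trans (add_le_add (habs.trans ?_) (habs.trans ?_)))
      (habs.trans ?_)))
  · refine lintegral_mono fun x => ?_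
    rw [enorm_mul, enorm_smul, enorm_norm]
    refine mul_le_mul' ?_ ((fderiv ℝ χ x).le_opENorm _)
    rw [enorm_le_iff_norm_le, Real.norm_of_nonneg (renorm_nonneg _)]
    exact renorm_le_abs _
  · refine lintegral_mono fun x => ?_
    rw [enorm_mul, ← enorm_pow]
    gcongr
    rw [enorm_le_iff_norm_le, Real.norm_of_nonneg (renorm_nonneg _),
      Real.norm_of_nonneg (sq_nonneg _)]
    exact renorm_le_sq _
  · exact lintegral_mono fun x => enorm_le_iff_norm_le.2 (hcn x)

/-- Mollification is a contraction of `L²`. -/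
lemma eLpNorm_mollify_le (n : ℕ) (ham : StronglyMeasurable a) :
    eLpNorm (mollify (mollifier n) a) 2 volume ≤ eLpNorm a 2 volume := by
  -- With the kernel turned into a probability measure, the contraction property is Jensen's
  -- inequality followed by Tonelli.
  set ν : Measure E3 := volume.withDensity fun h => ENNReal.ofReal (mollifier n h)
  have hρm : Measurable fun h => ENNReal.ofReal (mollifier n h) :=
    ((isTest_mollifier n).continuous.measurable).ennreal_ofReal
  have hν : IsProbabilityMeasure ν := ⟨by
    rw [withDensity_apply _ MeasurableSet.univ, Measure.restrict_univ,
      ← ofReal_integral_eq_lintegral_ofReal ((isTest_mollifier n).continuous.integrable_of_hasCompactSupport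
        (isTest_mollifier n).2) (ae_of_all _ (mollifier_nonneg n)), integral_mollifier]
    simp⟩
  have ham2 : StronglyMeasurable fun p : E3 × E3 => a (p.1 - p.2) :=
    ham.comp_measurable (measurable_fst.sub measurable_snd)
  rw [← ENNReal.pow_le_pow_left_iff (n := 2) (by norm_num), eLpNorm_two_sq, eLpNorm_two_sq]
  calc ∫⁻ x, ‖mollify (mollifier n) a x‖ₑ ^ 2
      ≤ ∫⁻ x, ∫⁻ h, ‖a (x - h)‖ₑ ^ 2 ∂ν := by
        refine lintegral_mono fun x => ?_
        have hx : StronglyMeasurable fun h => a (x - h) :=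
          ham.comp_measurable (measurable_const.sub measurable_id)
        refine le_trans ?_ (lintegral_sq_le_lintegral_sq hx.aestronglyMeasurable)
        gcongr
        rw [mollify, ← integral_sub_left_eq_self _ volume x,
          lintegral_withDensity_eq_lintegral_mul _ hρm hx.enorm]
        refine (enorm_integral_le_lintegral_enorm _).trans (lintegral_mono fun h => ?_)
        simp only [sub_sub_cancel, Pi.mul_apply]
        rw [enorm_mul, mul_comm, Real.enorm_of_nonneg (mollifier_nonneg n h)]
    _ = ∫⁻ h, (∫⁻ x, ‖a (x - h)‖ₑ ^ 2) ∂ν :=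
        lintegral_lintegral_swap (ham2.enorm.pow_const 2).aemeasurable
    _ = ∫⁻ _h, (∫⁻ x, ‖a x‖ₑ ^ 2) ∂ν := by
        refine lintegral_congr fun h => ?_
        exact lintegral_sub_right_eq_self (fun x => ‖a x‖ₑ ^ 2) h
    _ = _ := by simp

end SliceInequality

/-! ### Weak derivatives and the chain rule in time -/

section Time

lemma locallyIntegrable_intervalIntegrable {F : ℝ → ℝ} (hF : LocallyIntegrable F volume) (a b : ℝ) :
    IntervalIntegrable F volume a b :=
  intervalIntegrable_iff.2
    ((hF.integrableOn_isCompact isCompact_uIcc).mono_set uIoc_subset_uIcc)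

/-- The bound on the slope makes `renorm` 1-Lipschitz, and composition with a Lipschitz function
preserves absolute continuity. -/
lemma AbsolutelyContinuousOnInterval.renorm_comp {f : ℝ → ℝ} {a b : ℝ}
    (hf : AbsolutelyContinuousOnInterval f a b) :
    AbsolutelyContinuousOnInterval (fun t => renorm (f t)) a b := by
  have hL : ∀ x y, dist (renorm x) (renorm y) ≤ dist x y := fun x y => by
    have := Convex.norm_image_sub_le_of_norm_deriv_le (f := renorm) (C := 1) (s := univ)
      (fun s _ => contDiff_renorm.differentiable (by simp) s)
      (fun s _ => by simpa using abs_deriv_renorm_le s) convex_univ (mem_univ y) (mem_univ x)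
    simpa [dist_eq_norm] using this
  rw [absolutelyContinuousOnInterval_iff] at hf ⊢
  intro ε hε
  obtain ⟨δ, hδ, h⟩ := hf ε hε
  exact ⟨δ, hδ, fun E hE hE' =>
    (Finset.sum_le_sum fun i _ => hL _ _).trans_lt (h E hE hE')⟩

/-- The chain rule for `renorm` along a primitive. -/
lemma renorm_integral_eq {F : ℝ → ℝ} (hF : LocallyIntegrable F volume) (t : ℝ) :
    renorm (∫ s in (0 : ℝ)..t, F s)
      = ∫ s in (0 : ℝ)..t, deriv renorm (∫ r in (0 : ℝ)..s, F r) * F s := by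
  have hac := AbsolutelyContinuousOnInterval.renorm_comp
    ((locallyIntegrable_intervalIntegrable hF 0 t).absolutelyContinuousOnInterval_intervalIntegral
      (c := 0) (by simp))
  have h := hac.integral_deriv_eq_sub
  simp only [intervalIntegral.integral_same, renorm_zero, sub_zero] at h
  rw [← h]
  refine intervalIntegral.integral_congr_ae ?_
  filter_upwards [LocallyIntegrable.ae_hasDerivAt_integral hF] with s hs _
  exact ((contDiff_renorm.differentiable (by simp) _).hasDerivAt.comp s (hs 0)).deriv

lemma contDiff_integral {g : ℝ → ℝ} (hg : ContDiff ℝ ∞ g) :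
    ContDiff ℝ ∞ fun t => ∫ s in (0 : ℝ)..t, g s := by
  have hd : ∀ t, HasDerivAt (fun t => ∫ s in (0 : ℝ)..t, g s) (g t) t := fun t =>
    hg.continuous.integral_hasStrictDerivAt 0 t |>.hasDerivAt
  rw [contDiff_infty_iff_deriv]
  refine ⟨fun t => (hd t).differentiableAt, ?_⟩
  rwa [show deriv (fun t => ∫ s in (0 : ℝ)..t, g s) = g from funext fun t => (hd t).deriv]

/-- A weak solution of `m' = F`, both supported in `t > 0`, is the primitive of `F`. -/
lemma ae_eq_integral_of_weak {m F : ℝ → ℝ} (hm : LocallyIntegrable m volume)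
    (hF : LocallyIntegrable F volume) (hm0 : ∀ t ≤ 0, m t = 0) (hF0 : ∀ t ≤ 0, F t = 0)
    (h : ∀ η : ℝ → ℝ, IsTest η → ∫ t, (deriv η t * m t + η t * F t) = 0) :
    ∀ᵐ t, m t = ∫ s in (0 : ℝ)..t, F s := by
  have hFi := locallyIntegrable_intervalIntegrable hF
  have hA : Continuous fun t => ∫ s in (0 : ℝ)..t, F s :=
    intervalIntegral.continuous_primitive hFi 0
  have hA0 : ∀ t ≤ 0, ∫ s in (0 : ℝ)..t, F s = 0 := fun t ht =>
    intervalIntegral.integral_zero_ae (ae_of_all _ fun s hs =>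
      hF0 s (by rw [uIoc_of_ge ht] at hs; exact hs.2))
  have key : ∀ᵐ t, m t - ∫ s in (0 : ℝ)..t, F s = 0 := by
    refine ae_eq_zero_of_integral_contDiff_smul_eq_zero (hm.sub hA.locallyIntegrable)
      fun g hg hgs => ?_
    obtain ⟨T, hT⟩ := hgs.isCompact.isBounded.subset_closedBall (0 : ℝ)
    wlog hT0 : 0 < T generalizing T
    · exact this 1 (hT.trans (Metric.closedBall_subset_closedBall (by linarith))) one_pos
    have hgT : ∀ t, T < t → g t = 0 := fun t ht => image_eq_zero_of_notMem_tsupport fun hc => by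
      have := hT hc
      rw [Metric.mem_closedBall, dist_zero_right, Real.norm_eq_abs] at this
      linarith [le_abs_self t]
    set P : ℝ → ℝ := fun t => ∫ s in (0 : ℝ)..t, g s
    have hP : ContDiff ℝ ∞ P := contDiff_integral hg
    have hPd : ∀ t, HasDerivAt P (g t) t := fun t =>
      (hg.continuous.integral_hasStrictDerivAt 0 t).hasDerivAt
    have hPT : ∀ t, T ≤ t → P t = P T := fun t ht => by
      have e := intervalIntegral.integral_add_adjacent_intervals (μ := volume)
        (hg.continuous.intervalIntegrable 0 T) (hg.continuous.intervalIntegrable T t)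
      have e0 : ∫ s in T..t, g s = 0 := intervalIntegral.integral_zero_ae (ae_of_all _ fun s hs =>
        hgT s (by rw [uIoc_of_le ht] at hs; exact hs.1))
      simp only [P, ← e, e0, add_zero]
    let κ : ContDiffBump (0 : ℝ) := ⟨T + 1, T + 2, by linarith, by linarith⟩
    -- An antiderivative of `g` that vanishes after `T`, truncated by `κ` for negative times only:
    -- `κ = 1` up to `T + 1`, and `P - P T` is zero beyond `T`. In general `η` does not vanish at
    -- `0`, and this is how the zero initial value is used.
    set η : ℝ → ℝ := fun t => (P t - P T) * κ t
    have hη : IsTest η := ⟨(hP.sub contDiff_const).mul κ.contDiff, κ.hasCompactSupport.mul_left⟩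
    have hη1 : ∀ t, 0 < t → η t = P t - P T := fun t ht => by
      rcases le_or_gt t (T + 1) with h1 | h1
      · have : κ t = 1 := κ.one_of_mem_closedBall (by
          rw [Metric.mem_closedBall, dist_zero_right, Real.norm_of_nonneg ht.le]; exact h1)
        simp [η, this]
      · simp [η, hPT t (by linarith)]
    have hη2 : ∀ t, 0 < t → deriv η t = g t := fun t ht => by
      have he : η =ᶠ[𝓝 t] fun t => P t - P T := by
        filter_upwards [lt_mem_nhds ht] with s hs using hη1 s hs
      rw [he.deriv_eq, ((hPd t).sub_const _).deriv]
    have hw := h η hη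
    have i1 : Integrable (fun t => g t * m t) volume := by
      simpa using hm.integrable_smul_left_of_hasCompactSupport hg.continuous hgs
    have i2 : Integrable (fun t => η t * F t) volume := by
      simpa using hF.integrable_smul_left_of_hasCompactSupport hη.1.continuous hη.2
    have i3 : Integrable (fun t => g t * ∫ s in (0 : ℝ)..t, F s) volume :=
      (hg.continuous.mul hA).integrable_of_hasCompactSupport hgs.mul_right
    have hw1 : ∫ t, (deriv η t * m t + η t * F t) = (∫ t, g t * m t) + ∫ t, η t * F t := by
      rw [← integral_add i1 i2]
      refine integral_congr_ae (ae_of_all _ fun t => ?_)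
      rcases le_or_gt t 0 with h0 | h0
      · simp [hm0 t h0]
      · simp [hη2 t h0]
    have hset : ∀ f : ℝ → ℝ, (∀ t ≤ 0, f t = 0) → (∀ t, T < t → f t = 0) →
        ∫ t, f t = ∫ t in (0 : ℝ)..T, f t := fun f h1 h2 => by
      rw [intervalIntegral.integral_of_le hT0.le]
      refine (setIntegral_eq_integral_of_forall_compl_eq_zero fun t ht => ?_).symm
      rw [mem_Ioc, not_and_or, not_lt, not_le] at ht
      exact ht.elim (h1 t) (h2 t)
    -- Both boundary terms vanish: `P - P T` at `T`, and the primitive of `F` at `0`.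
    have hibp : ∫ t, η t * F t = - ∫ t, g t * ∫ s in (0 : ℝ)..t, F s := by
      have acP : AbsolutelyContinuousOnInterval (fun t => P t - P T) 0 T :=
        ((hP.sub contDiff_const).of_le (by simp)).contDiffOn.absolutelyContinuousOnInterval
      have acA := (hFi 0 T).absolutelyContinuousOnInterval_intervalIntegral (c := 0) (by simp)
      have e := acP.integral_mul_deriv_eq_deriv_mul acA
      simp only [sub_self, zero_mul, intervalIntegral.integral_same, mul_zero, zero_sub] at e
      rw [hset _ (fun t ht => by simp [hF0 t ht])
          (fun t ht => by rw [hη1 t (hT0.trans ht), hPT t ht.le]; simp),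
        hset _ (fun t ht => by simp [hA0 t ht]) (fun t ht => by simp [hgT t ht])]
      have e1 : ∫ t in (0 : ℝ)..T, η t * F t = ∫ t in (0 : ℝ)..T,
          (P t - P T) * deriv (fun x => ∫ v in (0 : ℝ)..x, F v) t := by
        refine intervalIntegral.integral_congr_ae ?_
        filter_upwards [LocallyIntegrable.ae_hasDerivAt_integral hF] with t ht htm
        rw [uIoc_of_le hT0.le] at htm
        rw [(ht 0).deriv, hη1 t htm.1]
      rw [e1, e]
      congr 1
      refine intervalIntegral.integral_congr fun t _ => ?_
      simp only [((hPd t).sub_const (P T)).deriv]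
    simp only [smul_eq_mul, mul_sub]
    rw [integral_sub i1 i3]
    linarith
  filter_upwards [key] with t ht
  linarith

end Time

/-! ### Cutoff functions and decay of the flux at infinity -/

section Cutoff

/-- The profile of the cutoff functions. -/
noncomputable def cutoffProfile : ContDiffBump (0 : E3) := ⟨1, 2, one_pos, one_lt_two⟩

/-- A cutoff function at scale `j + 1`. -/
noncomputable def cutoff (j : ℕ) (x : E3) : ℝ := cutoffProfile (((j : ℝ) + 1)⁻¹ • x)

lemma isTest_cutoffProfile : IsTest cutoffProfile :=
  ⟨cutoffProfile.contDiff, cutoffProfile.hasCompactSupport⟩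

lemma IsTest.comp_smul {F : Type*} [NormedAddCommGroup F] [NormedSpace ℝ F] {φ : E3 → F}
    (hφ : IsTest φ) {c : ℝ} (hc : c ≠ 0) : IsTest fun x => φ (c • x) :=
  ⟨hφ.1.comp (contDiff_const_smul c), hφ.2.comp_homeomorph (Homeomorph.smulOfNeZero c hc)⟩

lemma isTest_cutoff (j : ℕ) : IsTest (cutoff j) :=
  isTest_cutoffProfile.comp_smul (by positivity)

lemma cutoff_nonneg (j : ℕ) (x : E3) : 0 ≤ cutoff j x := cutoffProfile.nonneg

lemma cutoff_le_one (j : ℕ) (x : E3) : cutoff j x ≤ 1 := cutoffProfile.le_one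

lemma cutoff_eq_one {j : ℕ} {x : E3} (hx : ‖x‖ ≤ (j : ℝ) + 1) : cutoff j x = 1 := by
  refine cutoffProfile.one_of_mem_closedBall ?_
  have hj : (0 : ℝ) < (j : ℝ) + 1 := by positivity
  rw [Metric.mem_closedBall, dist_zero_right, norm_smul, norm_inv, Real.norm_of_nonneg hj.le]
  exact (inv_mul_le_iff₀ hj).2 (by simpa [cutoffProfile] using hx)

lemma tendsto_cutoff (x : E3) : Tendsto (fun j => cutoff j x) atTop (𝓝 1) := by
  obtain ⟨N, hN⟩ := exists_nat_ge ‖x‖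
  refine tendsto_const_nhds.congr' ?_
  filter_upwards [eventually_ge_atTop N] with j hj
  have : (N : ℝ) ≤ j := by exact_mod_cast hj
  exact (cutoff_eq_one (by linarith)).symm

lemma fderiv_comp_smul {F : Type*} [NormedAddCommGroup F] [NormedSpace ℝ F] {φ : E3 → F}
    (hφ : Differentiable ℝ φ) (c : ℝ) (x : E3) :
    fderiv ℝ (fun x => φ (c • x)) x = c • fderiv ℝ φ (c • x) := by
  have h := ((hφ (c • x)).hasFDerivAt.comp x
    (c • ContinuousLinearMap.id ℝ E3).hasFDerivAt).fderiv
  have h' : fderiv ℝ (fun x => φ (c • x)) x = _ := h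
  rw [h']
  ext y
  simp

lemma partialDeriv_comp_smul {F : Type*} [NormedAddCommGroup F] [NormedSpace ℝ F] {φ : E3 → F}
    (hφ : Differentiable ℝ φ) (c : ℝ) (i : Fin 3) :
    partialDeriv i (fun x => φ (c • x)) = fun x => c • partialDeriv i φ (c • x) := by
  ext x : 1
  simp [partialDeriv, fderiv_comp_smul hφ]

lemma lapl_comp_smul {φ : E3 → ℝ} (hφ : ContDiff ℝ ∞ φ) (c : ℝ) (x : E3) :
    lapl (fun x => φ (c • x)) x = c ^ 2 * lapl φ (c • x) := by
  unfold lapl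
  rw [Finset.mul_sum]
  refine Finset.sum_congr rfl fun i _ => ?_
  have hd : Differentiable ℝ (partialDeriv i φ) :=
    (contDiff_partialDeriv hφ i).differentiable (by simp)
  have h : partialDeriv i (fun x => c • partialDeriv i φ (c • x)) x
      = c • partialDeriv i (fun x => partialDeriv i φ (c • x)) x := by
    unfold partialDeriv
    rw [fderiv_fun_const_smul]
    · rfl
    · exact (hd.comp (differentiable_id.const_smul c)) x
  rw [partialDeriv_comp_smul (hφ.differentiable (by simp)), h, partialDeriv_comp_smul hd]
  simp only [smul_eq_mul]; ring

lemma fderiv_cutoff (j : ℕ) (x : E3) :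
    fderiv ℝ (cutoff j) x = ((j : ℝ) + 1)⁻¹ • fderiv ℝ cutoffProfile (((j : ℝ) + 1)⁻¹ • x) :=
  fderiv_comp_smul (isTest_cutoffProfile.1.differentiable (by simp)) _ x

lemma exists_lapl_cutoff_le :
    ∃ M : ℝ, ∀ j x, ‖lapl (cutoff j) x‖ ≤ M * (((j : ℝ) + 1)⁻¹) ^ 2 := by
  obtain ⟨M, hM⟩ := (continuous_lapl isTest_cutoffProfile.1).bounded_above_of_compact_support
    (hasCompactSupport_lapl isTest_cutoffProfile)
  refine ⟨M, fun j x => ?_⟩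
  have h : lapl (cutoff j) x = _ := lapl_comp_smul isTest_cutoffProfile.1 ((j : ℝ) + 1)⁻¹ x
  rw [h, norm_mul, mul_comm, norm_pow, Real.norm_of_nonneg (by positivity : 0 ≤ ((j : ℝ) + 1)⁻¹)]
  gcongr
  exact hM _

lemma fderiv_cutoff_eq_zero {j : ℕ} {x : E3} (hx : ‖x‖ < (j : ℝ) + 1) :
    fderiv ℝ (cutoff j) x = 0 := by
  have h : cutoff j =ᶠ[𝓝 x] fun _ => 1 := by
    have : ∀ᶠ y in 𝓝 x, ‖y‖ < (j : ℝ) + 1 := continuous_norm.continuousAt.eventually_lt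
      continuousAt_const hx
    filter_upwards [this] with y hy using cutoff_eq_one hy.le
  rw [h.fderiv_eq]
  simp

/-- The gradient of the cutoff functions is bounded in `L³`. -/
noncomputable def cutoffConst : ℝ≥0∞ := eLpNorm (fun x => ‖fderiv ℝ cutoffProfile x‖) 3 volume

lemma IsTest.memLp_norm_fderiv {φ : E3 → ℝ} (hφ : IsTest φ) (p : ℝ≥0∞) :
    MemLp (fun x => ‖fderiv ℝ φ x‖) p volume :=
  (hφ.1.continuous_fderiv (by simp)).norm.memLp_of_hasCompactSupport (hφ.2.fderiv ℝ).norm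

lemma cutoffConst_ne_top : cutoffConst ≠ ⊤ := (isTest_cutoffProfile.memLp_norm_fderiv 3).2.ne

/-- The exponent equals the dimension, so the factor `c` of the chain rule cancels the factor `c⁻¹`
produced by the dilation in `L³`. -/
lemma eLpNorm_fderiv_cutoff (j : ℕ) :
    eLpNorm (fun x => ‖fderiv ℝ (cutoff j) x‖) 3 volume = cutoffConst := by
  have hc : (0 : ℝ) < ((j : ℝ) + 1)⁻¹ := by positivity
  set c := ((j : ℝ) + 1)⁻¹
  have hD : Continuous (fderiv ℝ cutoffProfile) :=
    isTest_cutoffProfile.1.continuous_fderiv (by simp)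
  have h1 : (fun x => ‖fderiv ℝ (cutoff j) x‖)
      = c • ((fun x => ‖fderiv ℝ cutoffProfile x‖) ∘ fun x => c • x) := by
    ext x
    simp only [fderiv_cutoff, norm_smul, Pi.smul_apply, Function.comp_apply, smul_eq_mul]
    rw [Real.norm_of_nonneg hc.le]
  have hmap := Measure.map_addHaar_smul (volume : Measure E3) hc.ne'
  have h2 : eLpNorm ((fun x => ‖fderiv ℝ cutoffProfile x‖) ∘ fun x => c • x) 3 volume
      = ENNReal.ofReal c⁻¹ * cutoffConst := by
    rw [← eLpNorm_map_measure hD.norm.aestronglyMeasurable (by fun_prop), hmap,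
      eLpNorm_smul_measure_of_ne_top (by simp), cutoffConst, smul_eq_mul]
    congr 1
    simp only [finrank_euclideanSpace, Fintype.card_fin]
    rw [abs_of_pos (by positivity), ENNReal.ofReal_rpow_of_pos (by positivity), ← inv_pow,
      ← Real.rpow_natCast, ← Real.rpow_mul (by positivity)]
    simp
  rw [h1, eLpNorm_const_smul, h2, Real.enorm_of_nonneg hc.le, ← mul_assoc,
    ← ENNReal.ofReal_mul hc.le, mul_inv_cancel₀ hc.ne']
  simp

variable {u : E3 → E3} {G : Fin 3 → E3 → E3}

lemma HasGradientInL2.eLpNorm_fderiv_cutoff_smul_le (hu : HasGradientInL2 u G) (j : ℕ) :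
    eLpNorm (fun x => ‖fderiv ℝ (cutoff j) x‖ • u x) 2 volume
      ≤ sobolevConst * cutoffConst * gradNorm G := by
  rw [← eLpNorm_fderiv_cutoff j]
  exact hu.eLpNorm_smul_le ((isTest_cutoff j).memLp_norm_fderiv 3)

/-- Fields of the homogeneous Sobolev space vanish at infinity, in the weak sense needed here. -/
lemma HasGradientInL2.tendsto_eLpNorm_fderiv_cutoff_smul (hu : HasGradientInL2 u G) :
    Tendsto (fun j => eLpNorm (fun x => ‖fderiv ℝ (cutoff j) x‖ • u x) 2 volume) atTop (𝓝 0) := by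
  set K := sobolevConst * cutoffConst + 1
  have hK : K ≠ ⊤ := by
    simpa [K] using ENNReal.mul_ne_top sobolevConst_ne_top cutoffConst_ne_top
  have hK0 : K ≠ 0 := by simp [K]
  rw [ENNReal.tendsto_nhds_zero]
  intro ε hε
  obtain ⟨φ, hφ, hφG⟩ := hu.exists_gradNorm_sub_le (δ := ε / K)
    (ENNReal.div_ne_zero.2 ⟨hε.ne', hK⟩)
  obtain ⟨R, hR⟩ := hφ.2.isCompact.isBounded.subset_closedBall (0 : E3)
  obtain ⟨N, hN⟩ := exists_nat_ge R
  filter_upwards [eventually_ge_atTop N] with j hj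
  have hjR : (N : ℝ) ≤ j := by exact_mod_cast hj
  -- For `j` large the support of `φ` lies where the cutoff is constant, so `φ` can be subtracted
  -- from `u` at no cost.
  have heq : (fun x => ‖fderiv ℝ (cutoff j) x‖ • u x)
      = fun x => ‖fderiv ℝ (cutoff j) x‖ • (u - φ) x := by
    ext x : 1
    by_cases hx : x ∈ tsupport φ
    · have := hR hx
      rw [Metric.mem_closedBall, dist_zero_right] at this
      rw [fderiv_cutoff_eq_zero (by linarith)]
      simp
    · simp [image_eq_zero_of_notMem_tsupport hx]
  rw [heq]
  calc _ ≤ sobolevConst * cutoffConst * gradNorm (fun i => G i - partialDeriv i φ) :=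
        (hu.sub_test hφ).eLpNorm_fderiv_cutoff_smul_le j
    _ ≤ K * (ε / K) := by
        gcongr
        exact le_self_add
    _ ≤ ε := ENNReal.mul_div_le

end Cutoff

/-! ### Elementary inequalities and measurability of slices -/

lemma ennreal_mul_le_sq_add_sq (x y : ℝ≥0∞) : x * y ≤ x ^ 2 + y ^ 2 := by
  rcases le_total x y with h | h
  · exact (mul_le_mul' h le_rfl).trans ((sq y).symm.le.trans le_add_self)
  · exact (mul_le_mul' le_rfl h).trans ((sq x).symm.le.trans le_self_add)

lemma ennreal_le_one_add_sq (x : ℝ≥0∞) : x ≤ 1 + x ^ 2 := by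
  simpa using (ennreal_mul_le_sq_add_sq x 1).trans_eq (add_comm _ _)

/-- No integrability is needed: for a non-integrable `f` the Bochner integral is zero by convention.
-/
lemma ofReal_integral_le_lintegral_ofReal {α : Type*} [MeasurableSpace α] {μ : Measure α}
    (f : α → ℝ) : ENNReal.ofReal (∫ x, f x ∂μ) ≤ ∫⁻ x, ENNReal.ofReal (f x) ∂μ := by
  by_cases hf : Integrable f μ
  · calc ENNReal.ofReal (∫ x, f x ∂μ) ≤ ENNReal.ofReal (∫ x, max (f x) 0 ∂μ) :=
          ENNReal.ofReal_le_ofReal (integral_mono hf hf.pos_part fun x => le_max_left _ _)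
      _ = ∫⁻ x, ENNReal.ofReal (max (f x) 0) ∂μ :=
          ofReal_integral_eq_lintegral_ofReal hf.pos_part (ae_of_all _ fun x => le_max_right _ _)
      _ = _ := by simp
  · simp [integral_undef hf]

lemma measurable_eLpNorm_slice {F : Type*} [NormedAddCommGroup F] {f : ℝ × E3 → F}
    (hf : StronglyMeasurable f) : Measurable fun t => eLpNorm (fun x => f (t, x)) 2 volume := by
  simp only [eLpNorm_eq_lintegral_rpow_enorm_toReal (p := 2) (by norm_num : (2 : ℝ≥0∞) ≠ 0)
    (by simp)]
  exact Measurable.pow_const (Measurable.lintegral_prod_right' (f := fun p : ℝ × E3 =>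
    ‖f p‖ₑ ^ (2 : ℝ≥0∞).toReal) (hf.enorm.pow_const _)) _

/-! ### Bounds by the norms of the slices -/

section Pairing

variable {a : E3 → ℝ} {u : E3 → E3} {G : Fin 3 → E3 → E3}

lemma laplacian_eq_lapl {k : E3 → ℝ} (hk : IsTest k) (x : E3) :
    Laplacian.laplacian k x = lapl k x :=
  laplacian_eq_sum_partialDeriv (by exact_mod_cast contDiff_infty.1 hk.1 2) x

/-- The duality pairing in the weak formulation is controlled by the `L²` norms. -/
lemma lintegral_pairing_le {k : E3 → ℝ} (hk : IsTest k) (ha : AEStronglyMeasurable a volume)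
    (hu : HasGradientInL2 u G) :
    ∫⁻ y, ‖a y * (inner ℝ (u y) (gradient k y) + Laplacian.laplacian k y)‖ₑ
      ≤ eLpNorm a 2 volume * (sobolevConst * eLpNorm (fun x => ‖fderiv ℝ k x‖) 3 volume * gradNorm G
        + eLpNorm (lapl k) 2 volume) := by
  have hkm := hk.memLp_norm_fderiv 3
  have hlm : AEStronglyMeasurable (lapl k) volume := (continuous_lapl hk.1).aestronglyMeasurable
  have hsm : AEStronglyMeasurable (fun y => ‖fderiv ℝ k y‖ • u y) volume := (hu.memLp_smul hkm).1
  calc ∫⁻ y, ‖a y * (inner ℝ (u y) (gradient k y) + Laplacian.laplacian k y)‖ₑ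
      ≤ ∫⁻ y, (‖a y‖ₑ * ‖‖fderiv ℝ k y‖ • u y‖ₑ + ‖a y‖ₑ * ‖lapl k y‖ₑ) := by
        refine lintegral_mono fun y => ?_
        rw [enorm_mul, ← mul_add, laplacian_eq_lapl hk, inner_gradient_eq_fderiv]
        gcongr
        refine (enorm_add_le _ _).trans ?_
        gcongr
        rw [enorm_smul, enorm_norm]
        exact (fderiv ℝ k y).le_opENorm _
    _ = (∫⁻ y, ‖a y‖ₑ * ‖‖fderiv ℝ k y‖ • u y‖ₑ) + ∫⁻ y, ‖a y‖ₑ * ‖lapl k y‖ₑ :=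
        lintegral_add_left' (ha.enorm.mul hsm.enorm) _
    _ ≤ eLpNorm a 2 volume * (sobolevConst * eLpNorm (fun x => ‖fderiv ℝ k x‖) 3 volume * gradNorm G)
        + eLpNorm a 2 volume * eLpNorm (lapl k) 2 volume := by
        refine add_le_add ((lintegral_enorm_mul_enorm_le ha hsm).trans ?_)
          (lintegral_enorm_mul_enorm_le ha hlm)
        gcongr
        exact hu.eLpNorm_smul_le hkm
    _ = _ := (mul_add _ _ _).symm

lemma eLpNorm_const_sub {F : Type*} [NormedAddCommGroup F] {f : E3 → F} (hf : Continuous f)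
    (x : E3) (p : ℝ≥0∞) : eLpNorm (fun y => f (x - y)) p volume = eLpNorm f p volume :=
  eLpNorm_comp_measurePreserving (f := fun y => x - y) hf.aestronglyMeasurable
    (Measure.measurePreserving_sub_left volume x)

/-- The bound is uniform in `x`, since reflection and translation of `ρ` preserve norms. It makes
the source locally integrable in time for every `x`, not only for almost every one. -/
lemma enorm_source_le {ρ : E3 → ℝ} (hρ : IsTest ρ) (ha : AEStronglyMeasurable a volume)
    (hu : HasGradientInL2 u G) (x : E3) :
    ‖source ρ a u x‖ₑ ≤ eLpNorm a 2 volume *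
      (sobolevConst * eLpNorm (fun x => ‖fderiv ℝ ρ x‖) 3 volume * gradNorm G
        + eLpNorm (lapl ρ) 2 volume) := by
  refine (enorm_integral_le_lintegral_enorm _).trans
    ((lintegral_pairing_le (hρ.comp_const_sub x) ha hu).trans_eq ?_)
  have h1 : (fun y => ‖fderiv ℝ (fun y => ρ (x - y)) y‖) = fun y => ‖fderiv ℝ ρ (x - y)‖ := by
    ext y
    have h := ((hρ.1.differentiable (by simp) (x - y)).hasFDerivAt.comp y
      ((hasFDerivAt_id y).const_sub x)).fderiv
    have h' : fderiv ℝ (fun y => ρ (x - y)) y = _ := h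
    rw [h']
    simp
  have h2 : lapl (fun y => ρ (x - y)) = fun y => lapl ρ (x - y) := by
    ext y
    rw [← laplacian_eq_lapl (hρ.comp_const_sub x), laplacian_const_sub hρ]
    rfl
  rw [h1, h2, eLpNorm_const_sub (hρ.1.continuous_fderiv (by simp)).norm,
    eLpNorm_const_sub (continuous_lapl hρ.1)]

lemma enorm_mollify_le {ρ : E3 → ℝ} (hρ : IsTest ρ) (ha : AEStronglyMeasurable a volume) (x : E3) :
    ‖mollify ρ a x‖ₑ ≤ eLpNorm a 2 volume * eLpNorm ρ 2 volume := by
  refine (enorm_integral_le_lintegral_enorm _).trans ?_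
  simp only [enorm_mul]
  refine (lintegral_enorm_mul_enorm_le ha
    (hρ.comp_const_sub x).continuous.aestronglyMeasurable).trans_eq ?_
  rw [eLpNorm_const_sub hρ.continuous]

/-- As mollification is a contraction of `L²`, only the commutator term still depends on `n`. -/
lemma ofReal_integral_source_le_norms {χ : E3 → ℝ} {M : ℝ} (n : ℕ) (hχ : IsTest χ)
    (h0 : ∀ x, 0 ≤ χ x) (h1 : ∀ x, χ x ≤ 1) (hM : ∀ x, ‖lapl χ x‖ ≤ M) (ha : MemLp a 2 volume)
    (ham : StronglyMeasurable a) (hum : StronglyMeasurable u) (hu : HasGradientInL2 u G)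
    (hdiv : ∀ ψ : E3 → ℝ, IsTest ψ → ∫ x, inner ℝ (u x) (gradient ψ x) = 0) :
    ENNReal.ofReal (∫ x, χ x * (deriv renorm (mollify (mollifier n) a x)
        * source (mollifier n) a u x))
      ≤ eLpNorm a 2 volume * eLpNorm (fun x => ‖fderiv ℝ χ x‖ • u x) 2 volume
        + ENNReal.ofReal M * eLpNorm a 2 volume ^ 2
        + ∫⁻ x, ‖commutator (mollifier n) a u x‖ₑ := by
  have hg : AEStronglyMeasurable (mollify (mollifier n) a) volume :=
    (contDiff_mollify (isTest_mollifier n) (ha.locallyIntegrable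
      (by norm_num))).continuous.aestronglyMeasurable
  refine (ofReal_integral_source_le (isTest_mollifier n) hχ h0 h1 ha ham hum hu hdiv).trans
    (add_le_add (add_le_add ?_ ?_) le_rfl)
  · refine (lintegral_enorm_mul_enorm_le hg (hu.memLp_smul (hχ.memLp_norm_fderiv 3)).1).trans ?_
    gcongr
    exact eLpNorm_mollify_le n ham
  · calc _ ≤ ∫⁻ x, ENNReal.ofReal M * ‖mollify (mollifier n) a x‖ₑ ^ 2 := by
          refine lintegral_mono fun x => ?_
          rw [mul_comm, ← ofReal_norm (lapl χ x)]
          gcongr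
          exact hM x
      _ = ENNReal.ofReal M * eLpNorm (mollify (mollifier n) a) 2 volume ^ 2 := by
          rw [lintegral_const_mul' _ _ (by simp), eLpNorm_two_sq]
      _ ≤ _ := by
          gcongr
          exact eLpNorm_mollify_le n ham

end Pairing

/-! ### Data regular at every time, and space-time integrability -/

/-- A drift and a scalar field which are regular at every time. -/
structure IsRegularData (v : ℝ × E3 → E3) (D : Fin 3 → ℝ × E3 → E3) (a : ℝ × E3 → ℝ) :
    Prop where
  measurable_drift : StronglyMeasurable v
  measurable_grad : ∀ j, StronglyMeasurable (D j)
  measurable_sol : StronglyMeasurable a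
  hasGradient : ∀ t, HasGradientInL2 (fun x => v (t, x)) (fun j x => D j (t, x))
  divergenceFree : ∀ t, ∀ ψ : E3 → ℝ, IsTest ψ → ∫ x, inner ℝ (v (t, x)) (gradient ψ x) = 0
  memLp_slice : ∀ t, MemLp (fun x => a (t, x)) 2 volume
  eq_zero_of_nonpos : ∀ t ≤ 0, ∀ x, a (t, x) = 0
  lintegral_sol : ∫⁻ t, eLpNorm (fun x => a (t, x)) 2 volume ^ 2 ≠ ⊤
  lintegral_grad : ∫⁻ t, gradNorm (fun j x => D j (t, x)) ^ 2 ≠ ⊤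

/-- Regular data solving the equation, the weak formulation being restricted to products of a
function of time and a function of space. -/
structure IsRegularSolution (v : ℝ × E3 → E3) (D : Fin 3 → ℝ × E3 → E3) (a : ℝ × E3 → ℝ) : Prop
    extends IsRegularData v D a where
  weak : ∀ (η : ℝ → ℝ) (k : E3 → ℝ), IsTest η → IsTest k →
    ∫ t, (deriv η t * (∫ y, a (t, y) * k y) + η t * ∫ y, a (t, y) *
      (inner ℝ (v (t, y)) (gradient k y) + Laplacian.laplacian k y)) = 0

namespace IsRegularData

variable {v : ℝ × E3 → E3} {D : Fin 3 → ℝ × E3 → E3} {a : ℝ × E3 → ℝ}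

lemma sol_slice (h : IsRegularData v D a) (t : ℝ) : StronglyMeasurable fun x => a (t, x) :=
  h.measurable_sol.comp_measurable measurable_prodMk_left

lemma drift_slice (h : IsRegularData v D a) (t : ℝ) : StronglyMeasurable fun x => v (t, x) :=
  h.measurable_drift.comp_measurable measurable_prodMk_left

lemma measurable_norm (h : IsRegularData v D a) :
    Measurable fun t => eLpNorm (fun x => a (t, x)) 2 volume :=
  measurable_eLpNorm_slice h.measurable_sol

lemma measurable_gradNorm (h : IsRegularData v D a) :
    Measurable fun t => gradNorm (fun j x => D j (t, x)) :=
  Finset.measurable_fun_sum _ fun j _ => measurable_eLpNorm_slice (h.measurable_grad j)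

lemma lintegral_norm_mul_gradNorm (h : IsRegularData v D a) :
    ∫⁻ t, eLpNorm (fun x => a (t, x)) 2 volume * gradNorm (fun j x => D j (t, x)) ≠ ⊤ := by
  refine ne_top_of_le_ne_top (ENNReal.add_ne_top.2 ⟨h.lintegral_sol, h.lintegral_grad⟩) ?_
  rw [← lintegral_add_left (h.measurable_norm.pow_const 2)]
  exact lintegral_mono fun t => ennreal_mul_le_sq_add_sq _ _

/-- The product of the two norms is integrable over all times; the term linear in `‖a(t)‖₂` is
bounded through `x ≤ 1 + x²`, which requires a set of times of finite measure. -/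
lemma setLIntegral_bound_ne_top (h : IsRegularData v D a) {c₁ c₂ : ℝ≥0∞} (h₁ : c₁ ≠ ⊤)
    (h₂ : c₂ ≠ ⊤) {K : Set ℝ} (hK : volume K ≠ ⊤) :
    ∫⁻ t in K, eLpNorm (fun x => a (t, x)) 2 volume *
      (c₁ * gradNorm (fun j x => D j (t, x)) + c₂) ≠ ⊤ := by
  have hN := h.measurable_norm
  have hW := h.measurable_gradNorm
  have e1 : ∫⁻ t in K, c₁ * (eLpNorm (fun x => a (t, x)) 2 volume *
      gradNorm (fun j x => D j (t, x))) ≠ ⊤ := by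
    rw [lintegral_const_mul' _ _ h₁]
    exact ENNReal.mul_ne_top h₁ (ne_top_of_le_ne_top h.lintegral_norm_mul_gradNorm
      (setLIntegral_le_lintegral _ _))
  have e2 : ∫⁻ t in K, c₂ * (1 + eLpNorm (fun x => a (t, x)) 2 volume ^ 2) ≠ ⊤ := by
    rw [lintegral_const_mul' _ _ h₂, lintegral_add_left measurable_const]
    refine ENNReal.mul_ne_top h₂ (ENNReal.add_ne_top.2 ⟨by simpa using hK, ?_⟩)
    exact ne_top_of_le_ne_top h.lintegral_sol (setLIntegral_le_lintegral _ _)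
  refine ne_top_of_le_ne_top (ENNReal.add_ne_top.2 ⟨e1, e2⟩) ?_
  have hNW : Measurable fun t => c₁ * (eLpNorm (fun x => a (t, x)) 2 volume *
      gradNorm (fun j x => D j (t, x))) := (hN.mul hW).const_mul c₁
  rw [← lintegral_add_left hNW]
  refine lintegral_mono fun t => ?_
  rw [mul_add]
  refine add_le_add (mul_left_comm _ _ _).le ?_
  rw [mul_comm]
  gcongr
  exact ennreal_le_one_add_sq _

lemma integrable_of_slice_le (h : IsRegularData v D a) {η : ℝ → ℝ} (hη : IsTest η)
    {f : ℝ × E3 → ℝ} (hm : StronglyMeasurable fun z : ℝ × E3 => η z.1 * f z) {c₁ c₂ : ℝ≥0∞}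
    (h₁ : c₁ ≠ ⊤) (h₂ : c₂ ≠ ⊤) (hb : ∀ t, ∫⁻ y, ‖f (t, y)‖ₑ ≤
      eLpNorm (fun x => a (t, x)) 2 volume * (c₁ * gradNorm (fun j x => D j (t, x)) + c₂)) :
    Integrable (fun z : ℝ × E3 => η z.1 * f z) (volume.prod volume) := by
  obtain ⟨M, hM⟩ := hη.1.continuous.bounded_above_of_compact_support hη.2
  refine ⟨hm.aestronglyMeasurable, ?_⟩
  rw [HasFiniteIntegral, lintegral_prod _ hm.enorm.aemeasurable]
  refine lt_of_le_of_lt ?_ (ENNReal.mul_lt_top (ENNReal.ofReal_lt_top (r := M))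
    (h.setLIntegral_bound_ne_top h₁ h₂ (K := tsupport η) hη.2.isCompact.measure_lt_top.ne).lt_top)
  rw [← lintegral_const_mul' _ _ (by simp), ← lintegral_indicator hη.2.isCompact.measurableSet]
  refine lintegral_mono fun t => ?_
  simp only [enorm_mul]
  rw [lintegral_const_mul' _ _ (by simp)]
  by_cases ht : t ∈ tsupport η
  · rw [indicator_of_mem ht, ← ofReal_norm (η t)]
    exact mul_le_mul' (ENNReal.ofReal_le_ofReal (hM t)) (hb t)
  · simp [image_eq_zero_of_notMem_tsupport ht]

lemma integrable_mul_test (h : IsRegularData v D a) {η : ℝ → ℝ} {k : E3 → ℝ} (hη : IsTest η)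
    (hk : IsTest k) :
    Integrable (fun z : ℝ × E3 => η z.1 * (a z * k z.2)) (volume.prod volume) := by
  have hm : StronglyMeasurable fun z : ℝ × E3 => η z.1 * (a z * k z.2) :=
    (hη.1.continuous.stronglyMeasurable.comp_measurable measurable_fst).mul
      (h.measurable_sol.mul (hk.continuous.stronglyMeasurable.comp_measurable measurable_snd))
  exact h.integrable_of_slice_le hη hm (c₁ := 0) (by simp) (hk.memLp 2).2.ne fun t => by
    rw [zero_mul, zero_add]
    simp only [enorm_mul]
    exact lintegral_enorm_mul_enorm_le (h.sol_slice t).aestronglyMeasurable (hk.memLp 2).1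

lemma integrable_mul_pairing (h : IsRegularData v D a) {η : ℝ → ℝ} {k : E3 → ℝ} (hη : IsTest η)
    (hk : IsTest k) :
    Integrable (fun z : ℝ × E3 => η z.1 * (a z *
      (inner ℝ (v z) (gradient k z.2) + Laplacian.laplacian k z.2))) (volume.prod volume) := by
  have hm : StronglyMeasurable fun z : ℝ × E3 => η z.1 * (a z *
      (inner ℝ (v z) (gradient k z.2) + Laplacian.laplacian k z.2)) := by
    simp only [inner_gradient_eq_fderiv, laplacian_eq_lapl hk]
    exact (hη.1.continuous.stronglyMeasurable.comp_measurable measurable_fst).mul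
      (h.measurable_sol.mul ((stronglyMeasurable_fderiv_apply hk
        measurable_snd.stronglyMeasurable h.measurable_drift).add
        ((continuous_lapl hk.1).stronglyMeasurable.comp_measurable measurable_snd)))
  exact h.integrable_of_slice_le hη hm
    (ENNReal.mul_ne_top sobolevConst_ne_top (hk.memLp_norm_fderiv 3).2.ne)
    ((continuous_lapl hk.1).memLp_of_hasCompactSupport (hasCompactSupport_lapl hk)).2.ne
    fun t => lintegral_pairing_le hk (h.sol_slice t).aestronglyMeasurable (h.hasGradient t)

end IsRegularData

/-! ### Energy estimate for the mollified solution and vanishing of regular solutions -/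

namespace IsRegularSolution

variable {v : ℝ × E3 → E3} {D : Fin 3 → ℝ × E3 → E3} {a : ℝ × E3 → ℝ}

/-- The mollified solution. -/
noncomputable def moll (_ : IsRegularSolution v D a) (n : ℕ) (p : ℝ × E3) : ℝ :=
  mollify (mollifier n) (fun y => a (p.1, y)) p.2

/-- The time derivative of the mollified solution. -/
noncomputable def src (_ : IsRegularSolution v D a) (n : ℕ) (p : ℝ × E3) : ℝ :=
  source (mollifier n) (fun y => a (p.1, y)) (fun y => v (p.1, y)) p.2

/-- The primitive in time of `src`. -/
noncomputable def prim (h : IsRegularSolution v D a) (n : ℕ) (p : ℝ × E3) : ℝ :=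
  ∫ s in (0 : ℝ)..p.1, h.src n (s, p.2)

lemma stronglyMeasurable_moll (h : IsRegularSolution v D a) (n : ℕ) :
    StronglyMeasurable (h.moll n) := by
  refine StronglyMeasurable.integral_prod_right' (f := fun q : (ℝ × E3) × E3 =>
    a (q.1.1, q.2) * mollifier n (q.1.2 - q.2)) ?_
  exact (h.measurable_sol.comp_measurable (by fun_prop)).mul
    ((isTest_mollifier n).continuous.stronglyMeasurable.comp_measurable (by fun_prop))

lemma stronglyMeasurable_src (h : IsRegularSolution v D a) (n : ℕ) :
    StronglyMeasurable (h.src n) := by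
  have hρ := isTest_mollifier n
  have : h.src n = fun p => ∫ y, a (p.1, y) *
      (- fderiv ℝ (mollifier n) (p.2 - y) (v (p.1, y)) + lapl (mollifier n) (p.2 - y)) := by
    ext p
    simp only [src, source, inner_gradient_const_sub hρ, laplacian_const_sub hρ, lapl]
  rw [this]
  refine StronglyMeasurable.integral_prod_right' (f := fun q : (ℝ × E3) × E3 =>
    a (q.1.1, q.2) * (- fderiv ℝ (mollifier n) (q.1.2 - q.2) (v (q.1.1, q.2))
      + lapl (mollifier n) (q.1.2 - q.2))) ?_
  have hsub : Measurable fun q : (ℝ × E3) × E3 => q.1.2 - q.2 := by fun_prop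
  exact (h.measurable_sol.comp_measurable (by fun_prop)).mul
    ((stronglyMeasurable_fderiv_apply hρ hsub.stronglyMeasurable
      (h.measurable_drift.comp_measurable (by fun_prop))).neg.add
    ((continuous_lapl hρ.1).stronglyMeasurable.comp_measurable hsub))

lemma stronglyMeasurable_commutator_uncurry (h : IsRegularSolution v D a) (n : ℕ) :
    StronglyMeasurable fun p : ℝ × E3 =>
      commutator (mollifier n) (fun y => a (p.1, y)) (fun y => v (p.1, y)) p.2 := by
  refine StronglyMeasurable.integral_prod_right' (f := fun q : (ℝ × E3) × E3 =>
    a (q.1.1, q.2) * fderiv ℝ (mollifier n) (q.1.2 - q.2) (v q.1 - v (q.1.1, q.2))) ?_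
  have hsub : Measurable fun q : (ℝ × E3) × E3 => q.1.2 - q.2 := by fun_prop
  exact (h.measurable_sol.comp_measurable (by fun_prop)).mul
    (stronglyMeasurable_fderiv_apply (isTest_mollifier n) hsub.stronglyMeasurable
      ((h.measurable_drift.comp_measurable measurable_fst).sub
        (h.measurable_drift.comp_measurable (by fun_prop))))

lemma src_eq_zero (h : IsRegularSolution v D a) (n : ℕ) {t : ℝ} (ht : t ≤ 0) (x : E3) :
    h.src n (t, x) = 0 := by
  simp [src, source, h.eq_zero_of_nonpos t ht]

lemma moll_eq_zero (h : IsRegularSolution v D a) (n : ℕ) {t : ℝ} (ht : t ≤ 0) (x : E3) :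
    h.moll n (t, x) = 0 := by
  simp [moll, mollify, h.eq_zero_of_nonpos t ht]

/-- Moving the variable endpoint into an indicator gives a parametric integral with jointly
measurable integrand, whence the measurability of `prim`. -/
lemma prim_eq_integral (h : IsRegularSolution v D a) (n : ℕ) (p : ℝ × E3) :
    h.prim n p = ∫ s, {q : (ℝ × E3) × ℝ | 0 < q.2 ∧ q.2 ≤ q.1.1}.indicator
      (fun q => h.src n (q.2, q.1.2)) (p, s) := by
  rcases le_total 0 p.1 with hp | hp
  · rw [prim, intervalIntegral.integral_of_le hp, ← integral_indicator measurableSet_Ioc]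
    rfl
  · rw [prim, intervalIntegral.integral_zero_ae (ae_of_all _ fun s hs => h.src_eq_zero n
      (by rw [uIoc_of_ge hp] at hs; exact hs.2) _)]
    symm
    refine integral_eq_zero_of_ae (ae_of_all _ fun s => indicator_of_notMem ?_ _)
    simp only [mem_ofPred_eq, not_and, not_le]
    intro hs
    linarith

lemma stronglyMeasurable_prim (h : IsRegularSolution v D a) (n : ℕ) :
    StronglyMeasurable (h.prim n) := by
  rw [show h.prim n = _ from funext (h.prim_eq_integral n)]
  refine StronglyMeasurable.integral_prod_right' (f := {q : (ℝ × E3) × ℝ | 0 < q.2 ∧ q.2 ≤ q.1.1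
    }.indicator (fun q => h.src n (q.2, q.1.2))) ?_
  refine ((h.stronglyMeasurable_src n).comp_measurable (by fun_prop)).indicator ?_
  exact (measurableSet_lt measurable_const measurable_snd).inter
    (measurableSet_le measurable_snd (by fun_prop))

/-- The constants in the bound of `src`. -/
lemma exists_enorm_src_le (h : IsRegularSolution v D a) (n : ℕ) :
    ∃ c₁ c₂ : ℝ≥0∞, c₁ ≠ ⊤ ∧ c₂ ≠ ⊤ ∧ ∀ t x, ‖h.src n (t, x)‖ₑ ≤
      eLpNorm (fun x => a (t, x)) 2 volume * (c₁ * gradNorm (fun j x => D j (t, x)) + c₂) := by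
  have hρ := isTest_mollifier n
  refine ⟨sobolevConst * eLpNorm (fun x => ‖fderiv ℝ (mollifier n) x‖) 3 volume,
    eLpNorm (lapl (mollifier n)) 2 volume,
    ENNReal.mul_ne_top sobolevConst_ne_top (hρ.memLp_norm_fderiv 3).2.ne,
    ((continuous_lapl hρ.1).memLp_of_hasCompactSupport (hasCompactSupport_lapl hρ)).2.ne,
    fun t x => enorm_source_le hρ (h.sol_slice t).aestronglyMeasurable (h.hasGradient t) x⟩

lemma locallyIntegrable_src (h : IsRegularSolution v D a) (n : ℕ) (x : E3) :
    LocallyIntegrable (fun t => h.src n (t, x)) volume := by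
  obtain ⟨c₁, c₂, h₁, h₂, hb⟩ := h.exists_enorm_src_le n
  rw [locallyIntegrable_iff]
  intro K hK
  refine ⟨((h.stronglyMeasurable_src n).comp_measurable
    measurable_prodMk_right).aestronglyMeasurable, ?_⟩
  exact (lintegral_mono fun t => hb t x).trans_lt
    (h.setLIntegral_bound_ne_top h₁ h₂ hK.measure_lt_top.ne).lt_top

lemma locallyIntegrable_moll (h : IsRegularSolution v D a) (n : ℕ) (x : E3) :
    LocallyIntegrable (fun t => h.moll n (t, x)) volume := by
  have hρ := isTest_mollifier n
  rw [locallyIntegrable_iff]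
  intro K hK
  refine ⟨((h.stronglyMeasurable_moll n).comp_measurable
    measurable_prodMk_right).aestronglyMeasurable, ?_⟩
  refine (lintegral_mono fun t => ?_).trans_lt
    (h.setLIntegral_bound_ne_top (c₁ := 0) (c₂ := eLpNorm (mollifier n) 2 volume) (by simp)
      (hρ.memLp 2).2.ne hK.measure_lt_top.ne).lt_top
  rw [zero_mul, zero_add]
  exact enorm_mollify_le hρ (h.sol_slice t).aestronglyMeasurable x

/-- The mollified solution is almost everywhere equal to a primitive in time. -/
lemma moll_ae_eq_prim (h : IsRegularSolution v D a) (n : ℕ) :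
    ∀ᵐ t, ∀ᵐ x, h.moll n (t, x) = h.prim n (t, x) := by
  have hρ := isTest_mollifier n
  -- For fixed `x` the weak formulation is tested in space with `y ↦ ρₙ(x - y)`. The exceptional set
  -- of times depends on `x`; Fubini then exchanges the quantifiers.
  have key : ∀ᵐ x : E3, ∀ᵐ t : ℝ, h.moll n (t, x) = h.prim n (t, x) := ae_of_all _ fun x =>
    ae_eq_integral_of_weak (h.locallyIntegrable_moll n x) (h.locallyIntegrable_src n x)
      (fun t ht => h.moll_eq_zero n ht x) (fun t ht => h.src_eq_zero n ht x)
      fun η hη => h.weak η _ hη (hρ.comp_const_sub x)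
  have hm : MeasurableSet {p : E3 × ℝ | h.moll n (p.2, p.1) = h.prim n (p.2, p.1)} :=
    StronglyMeasurable.measurableSet_eq_fun
      ((h.stronglyMeasurable_moll n).comp_measurable measurable_swap)
      ((h.stronglyMeasurable_prim n).comp_measurable measurable_swap)
  exact (Measure.ae_ae_comm hm).1 key

/-- The total mass of the commutator. -/
noncomputable def commMass (_ : IsRegularSolution v D a) (n : ℕ) : ℝ≥0∞ :=
  ∫⁻ t, ∫⁻ x, ‖commutator (mollifier n) (fun y => a (t, y)) (fun y => v (t, y)) x‖ₑ

/-- Dominated convergence in time: each slice tends to zero, and the bound uniform in `n` gives an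
integrable majorant. -/
lemma tendsto_commMass (h : IsRegularSolution v D a) : Tendsto h.commMass atTop (𝓝 0) := by
  have := tendsto_lintegral_of_dominated_convergence (μ := (volume : Measure ℝ))
    (F := fun n t => ∫⁻ x, ‖commutator (mollifier n) (fun y => a (t, y)) (fun y => v (t, y)) x‖ₑ)
    (f := fun _ => 0)
    (fun t => ENNReal.ofReal mollifierMoment *
      (eLpNorm (fun x => a (t, x)) 2 volume * gradNorm (fun j x => D j (t, x))))
    (fun n => (h.stronglyMeasurable_commutator_uncurry n).enorm.lintegral_prod_right')
    (fun n => ae_of_all _ fun t => lintegral_commutator_le n (h.sol_slice t) (h.drift_slice t)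
      (h.hasGradient t))
    (by
      rw [lintegral_const_mul' _ _ (by simp)]
      exact ENNReal.mul_ne_top (by simp) h.lintegral_norm_mul_gradNorm)
    (ae_of_all _ fun t => tendsto_lintegral_commutator (h.sol_slice t) (h.memLp_slice t)
      (h.drift_slice t) (h.hasGradient t) ((h.hasGradient t).trace_eq_zero (h.divergenceFree t)))
  rw [lintegral_zero] at this
  exact this

/-- The localized energy inequality. -/
lemma lintegral_renorm_moll_le (h : IsRegularSolution v D a) (n : ℕ) {χ : E3 → ℝ} {M : ℝ}
    (hχ : IsTest χ) (h0 : ∀ x, 0 ≤ χ x) (h1 : ∀ x, χ x ≤ 1) (hM : ∀ x, ‖lapl χ x‖ ≤ M) :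
    ∀ᵐ t, ∫⁻ x, ENNReal.ofReal (χ x * renorm (h.moll n (t, x)))
      ≤ (∫⁻ s, eLpNorm (fun x => a (s, x)) 2 volume *
          eLpNorm (fun x => ‖fderiv ℝ χ x‖ • v (s, x)) 2 volume)
        + ENNReal.ofReal M * (∫⁻ s, eLpNorm (fun x => a (s, x)) 2 volume ^ 2) + h.commMass n := by
  filter_upwards [h.moll_ae_eq_prim n] with t ht
  rcases le_or_gt t 0 with ht0 | ht0
  · simp [h.moll_eq_zero n ht0, renorm_zero]
  obtain ⟨c₁, c₂, h₁, h₂, hb⟩ := h.exists_enorm_src_le n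
  have hβ : Continuous (deriv renorm) := contDiff_renorm.continuous_deriv (by simp)
  have hsm : StronglyMeasurable fun p : E3 × ℝ =>
      χ p.1 * (deriv renorm (h.prim n (p.2, p.1)) * h.src n (p.2, p.1)) :=
    (hχ.continuous.stronglyMeasurable.comp_measurable measurable_fst).mul
      ((hβ.comp_stronglyMeasurable ((h.stronglyMeasurable_prim n).comp_measurable
        measurable_swap)).mul ((h.stronglyMeasurable_src n).comp_measurable measurable_swap))
  have hint : Integrable (Function.uncurry fun (x : E3) (s : ℝ) =>
      χ x * (deriv renorm (h.prim n (s, x)) * h.src n (s, x)))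
      ((volume : Measure E3).prod (volume.restrict (Ioc 0 t))) := by
    refine ⟨hsm.aestronglyMeasurable, ?_⟩
    rw [HasFiniteIntegral, lintegral_prod]
    swap
    · exact hsm.enorm.aemeasurable
    have hfin := h.setLIntegral_bound_ne_top h₁ h₂ (K := Ioc 0 t) (by simp)
    set B := ∫⁻ s in Ioc 0 t, eLpNorm (fun x => a (s, x)) 2 volume *
      (c₁ * gradNorm (fun j x => D j (s, x)) + c₂)
    calc _ ≤ ∫⁻ x, ‖χ x‖ₑ * B := by
          refine lintegral_mono fun x => ?_
          rw [← lintegral_const_mul' _ _ (by simp)]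
          refine lintegral_mono fun s => ?_
          simp only [Function.uncurry]
          rw [enorm_mul, enorm_mul]
          refine mul_le_mul' le_rfl ((mul_le_of_le_one_left' ?_).trans (hb s x))
          rw [Real.enorm_eq_ofReal_abs]
          exact ENNReal.ofReal_le_one.2 (abs_deriv_renorm_le _)
      _ = (∫⁻ x, ‖χ x‖ₑ) * B := lintegral_mul_const' _ _ hfin
      _ < ⊤ := ENNReal.mul_lt_top
          (hχ.continuous.integrable_of_hasCompactSupport hχ.2).2 hfin.lt_top
  -- The chain rule in time is applied at each `x`, and Fubini then puts the space integral inside.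
  have hswap : ∫ x, χ x * renorm (h.prim n (t, x)) = ∫ s in Ioc 0 t, ∫ x,
      χ x * (deriv renorm (h.prim n (s, x)) * h.src n (s, x)) := by
    rw [← integral_integral_swap hint]
    refine integral_congr_ae (ae_of_all _ fun x => ?_)
    simp only [prim]
    rw [renorm_integral_eq (h.locallyIntegrable_src n x), intervalIntegral.integral_of_le ht0.le,
      ← integral_const_mul]
  have hpos : ∀ x, 0 ≤ χ x * renorm (h.prim n (t, x)) := fun x =>
    mul_nonneg (h0 x) (renorm_nonneg _)
  have hipos : Integrable (fun x => χ x * renorm (h.prim n (t, x))) volume := by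
    refine hint.integral_prod_left.congr (ae_of_all _ fun x => ?_)
    simp only [prim, Function.uncurry]
    rw [renorm_integral_eq (h.locallyIntegrable_src n x), intervalIntegral.integral_of_le ht0.le,
      ← integral_const_mul]
  have hm1 : Measurable fun s => eLpNorm (fun x => a (s, x)) 2 volume *
      eLpNorm (fun x => ‖fderiv ℝ χ x‖ • v (s, x)) 2 volume :=
    h.measurable_norm.mul (measurable_eLpNorm_slice
      (f := fun p => ‖fderiv ℝ χ p.2‖ • v p)
      (((hχ.1.continuous_fderiv (by simp)).norm.stronglyMeasurable.comp_measurable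
        measurable_snd).smul h.measurable_drift))
  calc ∫⁻ x, ENNReal.ofReal (χ x * renorm (h.moll n (t, x)))
      = ∫⁻ x, ENNReal.ofReal (χ x * renorm (h.prim n (t, x))) := by
        refine lintegral_congr_ae ?_
        filter_upwards [ht] with x hx
        rw [hx]
    _ = ENNReal.ofReal (∫ s in Ioc 0 t, ∫ x,
          χ x * (deriv renorm (h.prim n (s, x)) * h.src n (s, x))) := by
        rw [← hswap, ofReal_integral_eq_lintegral_ofReal hipos (ae_of_all _ hpos)]
    -- Passing to positive parts allows the integral to be extended to all times, so that the final
    -- bound does not depend on `t`.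
    _ ≤ ∫⁻ s, ENNReal.ofReal (∫ x,
          χ x * (deriv renorm (h.prim n (s, x)) * h.src n (s, x))) :=
        (ofReal_integral_le_lintegral_ofReal _).trans (setLIntegral_le_lintegral _ _)
    _ ≤ ∫⁻ s, (eLpNorm (fun x => a (s, x)) 2 volume *
          eLpNorm (fun x => ‖fderiv ℝ χ x‖ • v (s, x)) 2 volume
        + ENNReal.ofReal M * eLpNorm (fun x => a (s, x)) 2 volume ^ 2
        + ∫⁻ x, ‖commutator (mollifier n) (fun y => a (s, y)) (fun y => v (s, y)) x‖ₑ) := by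
        refine lintegral_mono_ae ?_
        filter_upwards [h.moll_ae_eq_prim n] with s hs
        refine le_trans (le_of_eq ?_) (ofReal_integral_source_le_norms n hχ h0 h1 hM
          (h.memLp_slice s) (h.sol_slice s) (h.drift_slice s) (h.hasGradient s)
          (h.divergenceFree s))
        congr 1
        refine integral_congr_ae ?_
        filter_upwards [hs] with x hx
        rw [← hx]
        rfl
    _ = _ := by
        have hm2 : Measurable fun s => ENNReal.ofReal M *
            eLpNorm (fun x => a (s, x)) 2 volume ^ 2 := (h.measurable_norm.pow_const 2).const_mul _
        rw [lintegral_add_left, lintegral_add_left hm1,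
          lintegral_const_mul' _ _ (by simp), commMass]
        exact hm1.add hm2

/-- The global energy inequality for the mollified solution. -/
lemma lintegral_renorm_moll_le_commMass (h : IsRegularSolution v D a) (n : ℕ) :
    ∀ᵐ t, ∫⁻ x, ENNReal.ofReal (renorm (h.moll n (t, x))) ≤ h.commMass n := by
  obtain ⟨M, hM⟩ := exists_lapl_cutoff_le
  -- A countable family of cutoffs keeps the exceptional set of times null.
  have hall : ∀ᵐ t, ∀ j : ℕ, ∫⁻ x, ENNReal.ofReal (cutoff j x * renorm (h.moll n (t, x)))
      ≤ (∫⁻ s, eLpNorm (fun x => a (s, x)) 2 volume *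
          eLpNorm (fun x => ‖fderiv ℝ (cutoff j) x‖ • v (s, x)) 2 volume)
        + ENNReal.ofReal (M * (((j : ℝ) + 1)⁻¹) ^ 2) *
          (∫⁻ s, eLpNorm (fun x => a (s, x)) 2 volume ^ 2) + h.commMass n :=
    ae_all_iff.2 fun j => h.lintegral_renorm_moll_le n (isTest_cutoff j) (cutoff_nonneg j)
      (cutoff_le_one j) (hM j)
  have lim1 : Tendsto (fun j => ∫⁻ s, eLpNorm (fun x => a (s, x)) 2 volume *
      eLpNorm (fun x => ‖fderiv ℝ (cutoff j) x‖ • v (s, x)) 2 volume) atTop (𝓝 0) := by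
    have := tendsto_lintegral_of_dominated_convergence (μ := (volume : Measure ℝ))
      (F := fun j s => eLpNorm (fun x => a (s, x)) 2 volume *
        eLpNorm (fun x => ‖fderiv ℝ (cutoff j) x‖ • v (s, x)) 2 volume) (f := fun _ => 0)
      (fun s => sobolevConst * cutoffConst * (eLpNorm (fun x => a (s, x)) 2 volume *
        gradNorm (fun i x => D i (s, x))))
      (fun j => h.measurable_norm.mul (measurable_eLpNorm_slice
        (f := fun p => ‖fderiv ℝ (cutoff j) p.2‖ • v p)
        ((((isTest_cutoff j).1.continuous_fderiv (by simp)).norm.stronglyMeasurable.comp_measurable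
          measurable_snd).smul h.measurable_drift)))
      (fun j => ae_of_all _ fun s => by
        exact (mul_le_mul' le_rfl ((h.hasGradient s).eLpNorm_fderiv_cutoff_smul_le j)).trans_eq
          (mul_left_comm _ _ _))
      (by
        have hc := ENNReal.mul_ne_top sobolevConst_ne_top cutoffConst_ne_top
        rw [lintegral_const_mul' _ _ hc]
        exact ENNReal.mul_ne_top hc h.lintegral_norm_mul_gradNorm)
      (ae_of_all _ fun s => by
        simpa using ENNReal.Tendsto.const_mul
          (h.hasGradient s).tendsto_eLpNorm_fderiv_cutoff_smul (Or.inr (h.memLp_slice s).2.ne))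
    simpa using this
  have lim2 : Tendsto (fun j : ℕ => ENNReal.ofReal (M * (((j : ℝ) + 1)⁻¹) ^ 2) *
      (∫⁻ s, eLpNorm (fun x => a (s, x)) 2 volume ^ 2)) atTop (𝓝 0) := by
    have e : Tendsto (fun j : ℕ => M * (((j : ℝ) + 1)⁻¹) ^ 2) atTop (𝓝 0) := by
      have := ((tendsto_one_div_add_atTop_nhds_zero_nat (𝕜 := ℝ)).pow 2).const_mul M
      simpa using this
    have := ENNReal.Tendsto.mul_const (ENNReal.tendsto_ofReal e) (Or.inr h.lintegral_sol)
    simpa using this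
  filter_upwards [hall] with t ht
  have hlim : Tendsto (fun j => (∫⁻ s, eLpNorm (fun x => a (s, x)) 2 volume *
          eLpNorm (fun x => ‖fderiv ℝ (cutoff j) x‖ • v (s, x)) 2 volume)
        + ENNReal.ofReal (M * (((j : ℝ) + 1)⁻¹) ^ 2) *
          (∫⁻ s, eLpNorm (fun x => a (s, x)) 2 volume ^ 2) + h.commMass n) atTop
      (𝓝 (h.commMass n)) := by
    simpa using (lim1.add lim2).add_const (h.commMass n)
  have hmm : Measurable fun x => h.moll n (t, x) :=
    ((h.stronglyMeasurable_moll n).comp_measurable measurable_prodMk_left).measurable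
  calc ∫⁻ x, ENNReal.ofReal (renorm (h.moll n (t, x)))
      = ∫⁻ x, liminf (fun j => ENNReal.ofReal (cutoff j x * renorm (h.moll n (t, x)))) atTop := by
        refine lintegral_congr fun x => ?_
        have := (ENNReal.tendsto_ofReal
          ((tendsto_cutoff x).mul_const (renorm (h.moll n (t, x))))).liminf_eq
        rw [this, one_mul]
    _ ≤ liminf (fun j => ∫⁻ x, ENNReal.ofReal (cutoff j x * renorm (h.moll n (t, x)))) atTop :=
        lintegral_liminf_le fun j => ((isTest_cutoff j).continuous.measurable.mul
          (contDiff_renorm.continuous.measurable.comp hmm)).ennreal_ofReal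
    _ ≤ h.commMass n := by
        rw [← hlim.liminf_eq]
        exact liminf_le_liminf (Eventually.of_forall ht)

/-- At a fixed time `aₙ → a` almost everywhere, so Fatou's lemma bounds `∫ β(a(t))` by the limit of
the commutator masses, which is zero; and `β` vanishes only at the origin. -/
theorem ae_eq_zero (h : IsRegularSolution v D a) : ∀ᵐ t, ∀ᵐ x, a (t, x) = 0 := by
  filter_upwards [ae_all_iff.2 h.lintegral_renorm_moll_le_commMass] with t ht
  have hlim := ae_tendsto_mollify ((h.memLp_slice t).locallyIntegrable (by norm_num))
  have hmm : ∀ n, Measurable fun x => h.moll n (t, x) := fun n =>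
    ((h.stronglyMeasurable_moll n).comp_measurable measurable_prodMk_left).measurable
  have hz : ∫⁻ x, ENNReal.ofReal (renorm (a (t, x))) = 0 := by
    refine le_antisymm ?_ zero_le
    calc ∫⁻ x, ENNReal.ofReal (renorm (a (t, x)))
        = ∫⁻ x, liminf (fun n => ENNReal.ofReal (renorm (h.moll n (t, x)))) atTop := by
          refine lintegral_congr_ae ?_
          filter_upwards [hlim] with x hx
          exact (ENNReal.tendsto_ofReal ((contDiff_renorm.continuous.tendsto _).comp
            hx)).liminf_eq.symm
      _ ≤ liminf (fun n => ∫⁻ x, ENNReal.ofReal (renorm (h.moll n (t, x)))) atTop :=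
          lintegral_liminf_le fun n =>
            (contDiff_renorm.continuous.measurable.comp (hmm n)).ennreal_ofReal
      _ ≤ 0 := by
          rw [← h.tendsto_commMass.liminf_eq]
          exact liminf_le_liminf (Eventually.of_forall ht)
  have hrm : Measurable fun x => ENNReal.ofReal (renorm (a (t, x))) :=
    (contDiff_renorm.continuous.measurable.comp (h.sol_slice t).measurable).ennreal_ofReal
  rw [lintegral_eq_zero_iff hrm] at hz
  filter_upwards [hz] with x hx
  exact eq_zero_of_renorm_eq_zero
    (le_antisymm (ENNReal.ofReal_eq_zero.1 hx) (renorm_nonneg _))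

end IsRegularSolution

/-! ### Reduction of the general case to regular data -/

lemma HasGradientInL2.congr {u u' : E3 → E3} {G G' : Fin 3 → E3 → E3} (h : HasGradientInL2 u G)
    (hu : u =ᵐ[volume] u') (hG : ∀ j, G j =ᵐ[volume] G' j) : HasGradientInL2 u' G' where
  locallyIntegrable := h.locallyIntegrable.congr hu
  memLp_gradient j := (memLp_congr_ae (hG j)).1 (h.memLp_gradient j)
  approx := by
    obtain ⟨φ, hφ, h1, h2⟩ := h.approx
    refine ⟨φ, hφ, fun j => (h1 j).congr fun n => eLpNorm_congr_ae ?_,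
      fun K hK => (h2 K hK).congr fun n => lintegral_congr_ae ?_⟩
    · filter_upwards [hG j] with x hx
      rw [hx]
    · filter_upwards [ae_restrict_of_ae hu] with x hx
      rw [hx]

lemma hasGradientInL2_zero : HasGradientInL2 (fun _ => 0) (fun _ _ => 0) where
  locallyIntegrable := locallyIntegrable_const 0
  memLp_gradient _ := MemLp.zero'
  approx := ⟨fun _ _ => 0, fun _ => ⟨contDiff_const, HasCompactSupport.zero⟩,
    fun j => by simp, fun K _ => by simp⟩

lemma ennreal_add_sq_le (x y : ℝ≥0∞) : (x + y) ^ 2 ≤ 3 * (x ^ 2 + y ^ 2) := by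
  calc (x + y) ^ 2 = x ^ 2 + y ^ 2 + 2 * (x * y) := by ring
    _ ≤ x ^ 2 + y ^ 2 + 2 * (x ^ 2 + y ^ 2) := by
        gcongr
        exact ennreal_mul_le_sq_add_sq x y
    _ = _ := by ring

lemma gradNorm_sq_le (G : Fin 3 → E3 → E3) :
    gradNorm G ^ 2 ≤ 9 * ∑ j, eLpNorm (G j) 2 volume ^ 2 := by
  simp only [gradNorm, Fin.sum_univ_three]
  set x := eLpNorm (G 0) 2 volume
  set y := eLpNorm (G 1) 2 volume
  set z := eLpNorm (G 2) 2 volume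
  calc (x + y + z) ^ 2 ≤ 3 * ((x + y) ^ 2 + z ^ 2) := ennreal_add_sq_le _ _
    _ ≤ 3 * (3 * (x ^ 2 + y ^ 2) + 3 * z ^ 2) := by
        gcongr
        · exact ennreal_add_sq_le _ _
        · exact le_mul_of_one_le_left' (by norm_num)
    _ = _ := by ring

lemma spaceTime_eq : spaceTime = ((volume : Measure ℝ).prod (volume : Measure E3)).restrict
    (Ioi 0 ×ˢ univ) := by
  rw [spaceTime, ← Measure.prod_restrict, Measure.restrict_univ]

lemma ae_memLp_slice {F : Type*} [NormedAddCommGroup F] {f : ℝ × E3 → F}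
    (hm : StronglyMeasurable f) (hf : MemLp f 2 spaceTime) :
    ∀ᵐ t ∂((volume : Measure ℝ).restrict (Ioi 0)), MemLp (fun x => f (t, x)) 2 volume := by
  have hL : eLpNorm f 2 spaceTime ^ 2 ≠ ⊤ := by simpa using hf.2.ne
  have hm2 : Measurable fun z : ℝ × E3 => ‖f z‖ₑ ^ 2 := hm.enorm.pow_const 2
  rw [eLpNorm_two_sq, spaceTime, lintegral_prod _ hm2.aemeasurable] at hL
  filter_upwards [ae_lt_top hm2.lintegral_prod_right' hL] with t ht
  refine ⟨(hm.comp_measurable measurable_prodMk_left).aestronglyMeasurable, ?_⟩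
  rw [← eLpNorm_two_sq (fun x => f (t, x))] at ht
  exact (ENNReal.pow_lt_top_iff.1 ht).resolve_right (by norm_num)

/-- Restriction of a space-time function to a set of times. -/
noncomputable def onTimes {F : Type*} [Zero F] (S : Set ℝ) (f : ℝ × E3 → F) : ℝ × E3 → F :=
  (S ×ˢ univ).indicator f

section OnTimes

variable {F : Type*} [NormedAddCommGroup F] {S : Set ℝ} {f : ℝ × E3 → F}

lemma onTimes_of_mem {t : ℝ} (ht : t ∈ S) (x : E3) : onTimes S f (t, x) = f (t, x) :=
  indicator_of_mem (by simpa using ht) f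

lemma onTimes_of_notMem {t : ℝ} (ht : t ∉ S) (x : E3) : onTimes S f (t, x) = 0 :=
  indicator_of_notMem (by simpa using ht) f

lemma stronglyMeasurable_onTimes (hS : MeasurableSet S) (hf : StronglyMeasurable f) :
    StronglyMeasurable (onTimes S f) :=
  hf.indicator (hS.prod MeasurableSet.univ)

lemma lintegral_eLpNorm_onTimes_ne_top (hS : S ⊆ Ioi 0) (hm : StronglyMeasurable f)
    (hf : MemLp f 2 spaceTime) :
    ∫⁻ t, eLpNorm (fun x => onTimes S f (t, x)) 2 volume ^ 2 ≠ ⊤ := by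
  have h1 : eLpNorm f 2 spaceTime ^ 2 ≠ ⊤ := by simpa using hf.2.ne
  have hm2 : Measurable fun z : ℝ × E3 => ‖f z‖ₑ ^ 2 := hm.enorm.pow_const 2
  rw [eLpNorm_two_sq, spaceTime, lintegral_prod _ hm2.aemeasurable,
    ← lintegral_indicator measurableSet_Ioi] at h1
  refine ne_top_of_le_ne_top h1 (lintegral_mono fun t => ?_)
  rw [eLpNorm_two_sq]
  by_cases ht : t ∈ S
  · rw [indicator_of_mem (hS ht)]
    simp [onTimes_of_mem ht]
  · simp [onTimes_of_notMem ht]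

lemma onTimes_ae_eq (hS : ∀ᵐ t ∂((volume : Measure ℝ).restrict (Ioi 0)), t ∈ S) :
    onTimes S f =ᵐ[spaceTime] f := by
  have : ∀ᵐ z ∂spaceTime, z.1 ∈ S := Measure.quasiMeasurePreserving_fst.ae hS
  filter_upwards [this] with z hz
  exact onTimes_of_mem hz z.2

end OnTimes

lemma isTest_mul_prod {η : ℝ → ℝ} {k : E3 → ℝ} (hη : IsTest η) (hk : IsTest k) :
    IsTest fun z : ℝ × E3 => η z.1 * k z.2 := by
  refine ⟨(hη.1.comp contDiff_fst).mul (hk.1.comp contDiff_snd),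
    HasCompactSupport.intro (hη.2.isCompact.prod hk.2.isCompact) fun z hz => ?_⟩
  rw [mem_prod, not_and_or] at hz
  rcases hz with hz | hz <;> simp [image_eq_zero_of_notMem_tsupport hz]

/-- The weak formulation for products of a function of time and a function of space. -/
lemma IsRegularData.isRegularSolution {v : ℝ × E3 → E3} {D : Fin 3 → ℝ × E3 → E3}
    {a : ℝ × E3 → ℝ} (h : IsRegularData v D a)
    (hsol : IsDistributionalSolution v a (fun _ => 0)) : IsRegularSolution v D a where
  toIsRegularData := h
  weak η k hη hk := by
    have hη' : IsTest (deriv η) := ⟨hη.1.deriv' (n := ∞), hη.2.deriv⟩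
    have i1 := h.integrable_mul_test hη' hk
    have i2 := h.integrable_mul_pairing hη hk
    have hs := hsol _ (isTest_mul_prod hη hk)
    simp only [zero_mul, integral_zero, add_zero] at hs
    have hpt : ∀ z : ℝ × E3, a z * (deriv (fun s => η s * k z.2) z.1
        + inner ℝ (v z) (gradient (fun x => η z.1 * k x) z.2)
        + Laplacian.laplacian (fun x => η z.1 * k x) z.2)
        = deriv η z.1 * (a z * k z.2) + η z.1 * (a z *
          (inner ℝ (v z) (gradient k z.2) + Laplacian.laplacian k z.2)) := fun z => by
      have hk2 : ContDiffAt ℝ 2 k z.2 := (by exact_mod_cast contDiff_infty.1 hk.1 2 :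
        ContDiff ℝ 2 k).contDiffAt
      have e1 : deriv (fun s => η s * k z.2) z.1 = deriv η z.1 * k z.2 := by
        rw [deriv_mul_const (hη.1.differentiable (by simp) z.1)]
      have e2 : inner ℝ (v z) (gradient (fun x => η z.1 * k x) z.2)
          = η z.1 * inner ℝ (v z) (gradient k z.2) := by
        rw [inner_gradient_eq_fderiv, inner_gradient_eq_fderiv,
          fderiv_const_mul (hk.1.differentiable (by simp) z.2)]
        simp
      have e3 : Laplacian.laplacian (fun x => η z.1 * k x) z.2
          = η z.1 * Laplacian.laplacian k z.2 :=
        InnerProductSpace.laplacian_smul (η z.1) hk2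
      rw [e1, e2, e3]
      ring
    simp only [hpt] at hs
    have i12 : Integrable (fun z : ℝ × E3 => deriv η z.1 * (a z * k z.2) + η z.1 * (a z *
        (inner ℝ (v z) (gradient k z.2) + Laplacian.laplacian k z.2))) (volume.prod volume) :=
      i1.add i2
    -- As `a` vanishes for `t ≤ 0`, integration over `ℝ₊ × ℝ³` is integration over `ℝ × ℝ³`, where
    -- Fubini separates the variables.
    rw [spaceTime_eq, setIntegral_eq_integral_of_forall_compl_eq_zero, integral_prod _ i12] at hs
    swap
    · intro z hz
      have hz0 : z.1 ≤ 0 := by simpa using hz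
      have : a z = 0 := h.eq_zero_of_nonpos z.1 hz0 z.2
      simp [this]
    rw [← hs]
    refine integral_congr_ae ?_
    filter_upwards [i1.prod_right_ae, i2.prod_right_ae] with t h1 h2
    rw [integral_add h1 h2, integral_const_mul, integral_const_mul]

/-- The fields are replaced by strongly measurable representatives, kept on a measurable set of good
times of full measure in `ℝ₊` and set to zero elsewhere. All the properties then hold at every time,
and the weak formulation does not see the change. -/
theorem ae_eq_zero_of_isDistributionalSolution
    (v : ℝ × E3 → E3)
    (hv : MemL2HomSobolev v)
    (hdiv : IsDivergenceFree v)
    (a : ℝ × E3 → ℝ)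
    (ha : MemLp a 2 spaceTime)
    (hsol : IsDistributionalSolution v a (fun _ => 0)) :
    ∀ᵐ z ∂spaceTime, a z = 0 := by
  obtain ⟨hvm, D, hD, hgrad⟩ := hv
  have hgood : ∀ᵐ t ∂((volume : Measure ℝ).restrict (Ioi 0)),
      (∀ᵐ x, v (t, x) = hvm.mk v (t, x)) ∧ (∀ j, ∀ᵐ x, D j (t, x) = (hD j).1.mk (D j) (t, x)) ∧
      HasGradientInL2 (fun x => v (t, x)) (fun j x => D j (t, x)) ∧
      (∀ ψ : E3 → ℝ, IsTest ψ → ∫ x, inner ℝ (v (t, x)) (gradient ψ x) = 0) ∧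
      MemLp (fun x => ha.1.mk a (t, x)) 2 volume ∧ 0 < t := by
    have e1 := Measure.ae_ae_of_ae_prod hvm.ae_eq_mk
    have e2 : ∀ᵐ t ∂((volume : Measure ℝ).restrict (Ioi 0)),
        ∀ j, ∀ᵐ x, D j (t, x) = (hD j).1.mk (D j) (t, x) :=
      ae_all_iff.2 fun j => Measure.ae_ae_of_ae_prod (hD j).1.ae_eq_mk
    have e3 : ∀ᵐ t ∂((volume : Measure ℝ).restrict (Ioi 0)),
        MemLp (fun x => ha.1.mk a (t, x)) 2 volume :=
      ae_memLp_slice ha.1.stronglyMeasurable_mk ((memLp_congr_ae ha.1.ae_eq_mk).1 ha)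
    filter_upwards [e1, e2, hgrad, hdiv, e3, ae_restrict_mem measurableSet_Ioi]
      with t h1 h2 h3 h4 h5 h6 using ⟨h1, h2, h3, h4, h5, h6⟩
  obtain ⟨S, hSae, hSm, hS⟩ := hgood.exists_measurable_mem
  have hS0 : S ⊆ Ioi 0 := fun t ht => (hS t ht).2.2.2.2.2
  have hreg : IsRegularData (onTimes S (hvm.mk v)) (fun j => onTimes S ((hD j).1.mk (D j)))
      (onTimes S (ha.1.mk a)) :=
    { measurable_drift := stronglyMeasurable_onTimes hSm hvm.stronglyMeasurable_mk
      measurable_grad := fun j => stronglyMeasurable_onTimes hSm (hD j).1.stronglyMeasurable_mk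
      measurable_sol := stronglyMeasurable_onTimes hSm ha.1.stronglyMeasurable_mk
      hasGradient := fun t => by
        by_cases ht : t ∈ S
        · simp only [onTimes_of_mem ht]
          exact (hS t ht).2.2.1.congr (hS t ht).1 (hS t ht).2.1
        · simp only [onTimes_of_notMem ht]
          exact hasGradientInL2_zero
      divergenceFree := fun t ψ hψ => by
        by_cases ht : t ∈ S
        · simp only [onTimes_of_mem ht]
          rw [← (hS t ht).2.2.2.1 ψ hψ]
          refine integral_congr_ae ?_
          filter_upwards [(hS t ht).1] with x hx
          rw [hx]
        · simp [onTimes_of_notMem ht]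
      memLp_slice := fun t => by
        by_cases ht : t ∈ S
        · simpa only [onTimes_of_mem ht] using (hS t ht).2.2.2.2.1
        · simp only [onTimes_of_notMem ht]
          exact MemLp.zero'
      eq_zero_of_nonpos := fun t ht x => onTimes_of_notMem (fun h => not_lt.2 ht (hS0 h)) x
      lintegral_sol := lintegral_eLpNorm_onTimes_ne_top hS0 ha.1.stronglyMeasurable_mk
        ((memLp_congr_ae ha.1.ae_eq_mk).1 ha)
      lintegral_grad := by
        have hfin : ∀ j, ∫⁻ t, eLpNorm (fun x => onTimes S ((hD j).1.mk (D j)) (t, x)) 2 volume ^ 2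
            ≠ ⊤ := fun j => lintegral_eLpNorm_onTimes_ne_top hS0 (hD j).1.stronglyMeasurable_mk
          ((memLp_congr_ae (hD j).1.ae_eq_mk).1 (hD j))
        refine ne_top_of_le_ne_top ?_ (lintegral_mono fun t => gradNorm_sq_le _)
        rw [lintegral_const_mul' _ _ (by simp), lintegral_finsetSum _ fun j _ =>
          (measurable_eLpNorm_slice (stronglyMeasurable_onTimes hSm
            (hD j).1.stronglyMeasurable_mk)).pow_const 2]
        exact ENNReal.mul_ne_top (by simp) (ENNReal.sum_ne_top.2 fun j _ => hfin j) }
  have hva : onTimes S (hvm.mk v) =ᵐ[spaceTime] v :=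
    (onTimes_ae_eq hSae).trans hvm.ae_eq_mk.symm
  have haa : onTimes S (ha.1.mk a) =ᵐ[spaceTime] a :=
    (onTimes_ae_eq hSae).trans ha.1.ae_eq_mk.symm
  have hsol' : IsDistributionalSolution (onTimes S (hvm.mk v)) (onTimes S (ha.1.mk a))
      (fun _ => 0) := fun φ hφ => by
    refine Eq.trans ?_ (hsol φ hφ)
    congr 1
    refine integral_congr_ae ?_
    filter_upwards [hva, haa] with z h1 h2
    rw [h1, h2]
  have hz := (hreg.isRegularSolution hsol').ae_eq_zero
  have hzm : MeasurableSet {z : ℝ × E3 | onTimes S (ha.1.mk a) z = 0} :=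
    StronglyMeasurable.measurableSet_eq_fun hreg.measurable_sol stronglyMeasurable_const
  have hz' : ∀ᵐ z ∂spaceTime, onTimes S (ha.1.mk a) z = 0 :=
    (Measure.ae_prod_iff_ae_ae hzm).2 (ae_restrict_of_ae hz)
  filter_upwards [hz', haa] with z h1 h2
  rw [← h2, h1]

end TransportDiffusion

theorem theorem1
    (v : ℝ × TransportDiffusion.E3 → TransportDiffusion.E3)
    (hv : TransportDiffusion.MemL2HomSobolev v)
    (hdiv : TransportDiffusion.IsDivergenceFree v)
    (a : ℝ × TransportDiffusion.E3 → ℝ)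
    (ha : MeasureTheory.MemLp a 2 TransportDiffusion.spaceTime)
    (hsol : TransportDiffusion.IsDistributionalSolution v a (fun _ => 0)) :
    ∀ᵐ z ∂TransportDiffusion.spaceTime, a z = 0 :=
  TransportDiffusion.ae_eq_zero_of_isDistributionalSolution v hv hdiv a ha hsol
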